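/- Let $(\Omega,\mathcal A)$ be a measurable space, $\mathcal H$ a complex Hilbert space (not necessarily separable), and let $\mathsf E:\mathcal A\to\mathcal L(\mathcal H)$ be a positive operator valued measure (POVM), i.e. $\mathsf E(X)\ge 0$ for all $X\in\mathcal A$ and $X\mapsto \mathsf E(X)\varphi$ is $\sigma$-additive in norm for every $\varphi\in\mathcal H$ ($\mathsf E$ need not be normalized). Put $\mathsf E_{\psi,\varphi}(X)=\langle\psi|\mathsf E(X)\varphi\rangle$ (inner products are linear in the second argument). Let $f:\Omega\to[0,\infty)$ be measurable and suppose that the form domain $\mathcal D_0=\{\varphi\in\mathcal H : \int f\,d\mathsf E_{\varphi,\varphi}<\infty\}$, a linear subspace such that $f$ is $\mathsf E_{\psi,\varphi}$-integrable for all $\psi,\varphi\in\mathcal D_0$, is dense in $\mathcal H$. Then: 1. The form integral $q(\psi,\varphi)=\int f\,d\mathsf E_{\psi,\varphi}$, $\psi,\varphi\in\mathcal D_0$, is a symmetric, positive and closed sesquilinear form. (Closed means: if $\varphi_n\in\mathcal D_0$, $\varphi_n\to\varphi\in\mathcal H$ and $q(\varphi_n-\varphi_m,\varphi_n-\varphi_m)\to0$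 as $n,m\to\infty$, then $\varphi\in\mathcal D_0$ and $q(\varphi_n-\varphi,\varphi_n-\varphi)\to0$.) 2. There is a unique operator $T$ associated to $q$, that is, a unique positive selfadjoint operator $T$ with $\mathrm{dom}(\sqrt T)=\mathcal D_0$ and $q(\psi,\varphi)=\langle\sqrt T\psi|\sqrt T\varphi\rangle$ for all $\psi,\varphi\in\mathcal D_0$. 3. Let $(\mathcal K,\mathsf F,V)$ be any Naimark dilation of $\mathsf E$, i.e. $\mathcal K$ is a Hilbert space, $\mathsf F:\mathcal A\to\mathcal L(\mathcal K)$ is a spectral measure (a projection valued POVM with $\mathsf F(\Omega)=I$), $V:\mathcal H\to\mathcal K$ is a bounded linear map, and $\mathsf E(X)=V^*\mathsf F(X)V$ for all $X\in\mathcal A$. Let $L(\sqrt f,\mathsf F)$ be the strong operator integral: its domain is the set of $x\in\mathcal K$ for which $\sqrt f$ is integrable with respect to the vector measure $\mathsf F_x:X\mapsto\mathsf F(X)x$ (there are simple functions $s_n\to\sqrt f$ pointwise such that $\lim_n\int_X s_n\,d\mathsf F_x$ exists for every $X\in\mathcal A$), and $L(\sqrt f,\mathsf F)x=\int\sqrt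 f\,d\mathsf F_x=\lim_n\int_\Omega s_n\,d\mathsf F_x$. Then $$T=\big(L(\sqrt f,\mathsf F)V\big)^*\,L(\sqrt f,\mathsf F)V,$$ where products of operators have their natural domains. 4. $T=L'(f,\mathsf E)$, where $L'(f,\mathsf E)$, the largest symmetric weak operator integral determined by $f$ and $\mathsf E$, is the operator with domain $\{\varphi\in\mathcal D_0 : \psi\mapsto\int f\,d\mathsf E_{\psi,\varphi}\text{ is continuous on }\mathcal D_0\}$ (in the norm of $\mathcal H$) determined by $\langle\psi|L'(f,\mathsf E)\varphi\rangle=\int f\,d\mathsf E_{\psi,\varphi}$ for all $\psi\in\mathcal D_0$. In particular, $L'(f,\mathsf E)$ is selfadjoint. -/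

import Mathlib

open MeasureTheory Filter
open scoped ENNReal Topology ComplexConjugate InnerProductSpace

noncomputable section

/-! ## Partially defined operators -/

namespace LinearPMap

variable {E F G : Type*} [AddCommGroup E] [Module ℂ E] [AddCommGroup F] [Module ℂ F]
  [AddCommGroup G] [Module ℂ G]

/-- The composition `g ∘ f` of partially defined operators on its natural domain
`{x ∈ dom f | f x ∈ dom g}`. -/
def natComp (g : F →ₗ.[ℂ] G) (f : E →ₗ.[ℂ] F) : E →ₗ.[ℂ] G where
  domain := (g.domain.comap f.toFun).map f.domain.subtype
  toFun :=
    { toFun := fun x => g ⟨f ⟨x, by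
          obtain ⟨y, _, hy⟩ := x.2
          exact hy ▸ y.2⟩, by
          obtain ⟨y, hy', hy⟩ := x.2
          have : (⟨(x : E), hy ▸ y.2⟩ : f.domain) = y := Subtype.ext hy.symm
          rw [this]
          exact hy'⟩
      map_add' := fun x y => by
        rw [← g.map_add]
        congr 1
        apply Subtype.ext
        simp only [Submodule.coe_add]
        rw [← f.map_add]
        rfl
      map_smul' := fun c x => by
        rw [RingHom.id_apply, ← g.map_smul]
        congr 1
        apply Subtype.ext
        simp only [Submodule.coe_smul]
        rw [← f.map_smul]
        rfl }

theorem mem_natComp_domain {g : F →ₗ.[ℂ] G} {f : E →ₗ.[ℂ] F} {x : E} :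
    x ∈ (natComp g f).domain ↔ ∃ h : x ∈ f.domain, f ⟨x, h⟩ ∈ g.domain := by
  constructor
  · rintro ⟨y, hy, rfl⟩
    exact ⟨y.2, hy⟩
  · rintro ⟨h, hx⟩
    exact ⟨⟨x, h⟩, hx, rfl⟩

/-- Composition of a partially defined operator with an everywhere defined bounded operator. -/
def compBounded {E F : Type*} [NormedAddCommGroup E] [NormedSpace ℂ E]
    [NormedAddCommGroup F] [NormedSpace ℂ F] (g : F →ₗ.[ℂ] G) (V : E →L[ℂ] F) : E →ₗ.[ℂ] G :=
  natComp g ((V : E →ₗ[ℂ] F).toPMap ⊤)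

end LinearPMap

/-- A positive selfadjoint (in general unbounded) operator. -/
def IsPositiveSelfAdjoint {H : Type*} [NormedAddCommGroup H] [InnerProductSpace ℂ H]
    [CompleteSpace H] (T : H →ₗ.[ℂ] H) : Prop :=
  IsSelfAdjoint T ∧ ∀ x : T.domain, 0 ≤ (⟪(x : H), T x⟫_ℂ).re

/-! ## Sesquilinear forms and quadratic forms -/

/-- Sesquilinear forms on a subspace, antilinear in the first and linear in the second argument. -/
abbrev FormOn {H : Type*} [NormedAddCommGroup H] [InnerProductSpace ℂ H] (D : Submodule ℂ H) :=
  D →ₗ⋆[ℂ] D →ₗ[ℂ] ℂ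

namespace FormOn

variable {H : Type*} [NormedAddCommGroup H] [InnerProductSpace ℂ H] {D : Submodule ℂ H}

/-- `q(ψ, φ) = conj q(φ, ψ)`. -/
def IsSymm (q : FormOn D) : Prop := ∀ ψ φ : D, q ψ φ = conj (q φ ψ)

/-- `q(φ, φ) ≥ 0`, that is, `q(φ, φ)` is real and nonnegative. -/
def IsPos (q : FormOn D) : Prop := ∀ φ : D, 0 ≤ (q φ φ).re ∧ (q φ φ).im = 0

/-- A positive form is closed if `φₙ ∈ D`, `φₙ → φ` and `q(φₙ - φₘ, φₙ - φₘ) → 0` as `n, m → ∞`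
imply that `φ ∈ D` and `q(φₙ - φ, φₙ - φ) → 0`. -/
def IsClosed (q : FormOn D) : Prop :=
  ∀ (u : ℕ → D) (φ : H), Tendsto (fun n => (u n : H)) atTop (𝓝 φ) →
    Tendsto (fun p : ℕ × ℕ => q (u p.1 - u p.2) (u p.1 - u p.2)) (atTop ×ˢ atTop) (𝓝 0) →
    ∃ h : φ ∈ D, Tendsto (fun n => q (u n - ⟨φ, h⟩) (u n - ⟨φ, h⟩)) atTop (𝓝 0)

/-- `T` is an operator associated to the form `q`: it is positive and selfadjoint, and its
positive selfadjoint square root `S` satisfies `dom S = D` and `q(ψ, φ) = ⟪S ψ, S φ⟫`. -/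
def IsAssociated [CompleteSpace H] (q : FormOn D) (T : H →ₗ.[ℂ] H) : Prop :=
  IsPositiveSelfAdjoint T ∧
    ∃ S : H →ₗ.[ℂ] H, IsPositiveSelfAdjoint S ∧ S.natComp S = T ∧
      ∃ hS : S.domain = D, ∀ ψ φ : D,
        q ψ φ = ⟪S ⟨ψ, hS.symm ▸ ψ.2⟩, S ⟨φ, hS.symm ▸ φ.2⟩⟫_ℂ

theorem exists_unique_rep [CompleteSpace H] (hD : Dense (D : Set H)) (q : FormOn D) (φ : D)
    (hc : Continuous fun ψ : D => q ψ φ) : ∃! η : H, ∀ ψ : D, ⟪(ψ : H), η⟫_ℂ = q ψ φ := by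
  let l : StrongDual ℂ D :=
    { toFun := fun ψ => conj (q ψ φ)
      map_add' := fun a b => by simp
      map_smul' := fun c a => by simp
      cont := Complex.continuous_conj.comp hc }
  let e : D →L[ℂ] H := D.subtypeL
  have he : DenseRange e := by
    simpa [DenseRange, e] using hD
  have hu : IsUniformInducing e := isUniformEmbedding_subtype_val.isUniformInducing
  let L : StrongDual ℂ H := l.extend e
  refine ⟨(InnerProductSpace.toDual ℂ H).symm L, fun ψ => ?_, fun η hη => ?_⟩
  · rw [← inner_conj_symm, InnerProductSpace.toDual_symm_apply]
    have : L (e ψ) = l ψ := l.extend_eq he hu ψ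
    change conj (L (e ψ)) = _
    rw [this]
    simp [l]
  · refine hD.eq_of_inner_right (𝕜 := ℂ) fun v hv => ?_
    have h1 := hη ⟨v, hv⟩
    have h2 : L (e ⟨v, hv⟩) = l ⟨v, hv⟩ := l.extend_eq he hu ⟨v, hv⟩
    rw [h1, ← inner_conj_symm, InnerProductSpace.toDual_symm_apply]
    change _ = conj (L (e ⟨v, hv⟩))
    rw [h2]
    simp [l]

/-- The operator determined by a sesquilinear form `q` on a dense subspace `D`: its domain consists
of the `φ ∈ D` for which `ψ ↦ q(ψ, φ)` is continuous on `D`, and `T φ` is the unique vector with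
`⟪ψ, T φ⟫ = q(ψ, φ)` for all `ψ ∈ D`. -/
def toOperator [CompleteSpace H] (q : FormOn D) (hD : Dense (D : Set H)) : H →ₗ.[ℂ] H where
  domain :=
    { carrier := {φ | ∃ h : φ ∈ D, Continuous fun ψ : D => q ψ ⟨φ, h⟩}
      zero_mem' := ⟨D.zero_mem, by
        have : (⟨0, D.zero_mem⟩ : D) = 0 := rfl
        simp only [this, map_zero]
        exact continuous_const⟩
      add_mem' := by
        rintro a b ⟨ha, hca⟩ ⟨hb, hcb⟩
        refine ⟨D.add_mem ha hb, ?_⟩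
        have : (⟨a + b, D.add_mem ha hb⟩ : D) = ⟨a, ha⟩ + ⟨b, hb⟩ := rfl
        simp only [this, map_add]
        exact hca.add hcb
      smul_mem' := by
        rintro c a ⟨ha, hca⟩
        refine ⟨D.smul_mem c ha, ?_⟩
        have : (⟨c • a, D.smul_mem c ha⟩ : D) = c • ⟨a, ha⟩ := rfl
        simp only [this, map_smul]
        exact hca.const_smul c }
  toFun :=
    { toFun := fun φ => (exists_unique_rep hD q ⟨φ, φ.2.choose⟩ φ.2.choose_spec).choose
      map_add' := fun a b => by
        have ha := (exists_unique_rep hD q ⟨a, a.2.choose⟩ a.2.choose_spec).choose_spec.1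
        have hb := (exists_unique_rep hD q ⟨b, b.2.choose⟩ b.2.choose_spec).choose_spec.1
        refine ((exists_unique_rep hD q ⟨(a + b : _), (a + b).2.choose⟩
          (a + b).2.choose_spec).choose_spec.2 _ fun ψ => ?_).symm
        rw [inner_add_right]
        refine (congrArg₂ (· + ·) (ha ψ) (hb ψ)).trans ?_
        rw [← map_add]
        rfl
      map_smul' := fun c a => by
        have ha := (exists_unique_rep hD q ⟨a, a.2.choose⟩ a.2.choose_spec).choose_spec.1
        refine ((exists_unique_rep hD q ⟨(c • a : _), (c • a).2.choose⟩
          (c • a).2.choose_spec).choose_spec.2 _ fun ψ => ?_).symm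
        rw [RingHom.id_apply, inner_smul_right]
        refine (congrArg (c * ·) (ha ψ)).trans ?_
        rw [← smul_eq_mul, ← map_smul]
        rfl }

theorem inner_toOperator [CompleteSpace H] (q : FormOn D) (hD : Dense (D : Set H))
    (φ : (q.toOperator hD).domain) (ψ : D) :
    ⟪(ψ : H), q.toOperator hD φ⟫_ℂ = q ψ ⟨φ, φ.2.choose⟩ :=
  (exists_unique_rep hD q ⟨φ, φ.2.choose⟩ φ.2.choose_spec).choose_spec.1 ψ

end FormOn

/-! ## Integrals with respect to vector measures -/

namespace MeasureTheory.VectorMeasure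

variable {Ω F : Type*} [MeasurableSpace Ω] [NormedAddCommGroup F] [NormedSpace ℂ F]

/-- `∫_X s dμ` for a simple function `s` and a vector measure `μ`. -/
def simpleIntegral (μ : VectorMeasure Ω F) (s : SimpleFunc Ω ℂ) (X : Set Ω) : F :=
  ∑ c ∈ s.range, c • μ (s ⁻¹' {c} ∩ X)

/-- `f` is `μ`-integrable with `∫_Ω f dμ = ν`: there are simple functions `s n → f` pointwise such
that `∫_X s n dμ` converges for every measurable `X`, and `∫_Ω s n dμ → ν`. -/
def HasVectorIntegral (μ : VectorMeasure Ω F) (f : Ω → ℂ) (ν : F) : Prop :=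
  ∃ s : ℕ → SimpleFunc Ω ℂ, (∀ ω, Tendsto (fun n => s n ω) atTop (𝓝 (f ω))) ∧
    (∀ X, MeasurableSet X → ∃ l, Tendsto (fun n => μ.simpleIntegral (s n) X) atTop (𝓝 l)) ∧
    Tendsto (fun n => μ.simpleIntegral (s n) Set.univ) atTop (𝓝 ν)

/-- `∫ f dμ` for a complex measure `μ`. It is used only when `f` is `μ`-integrable, that is, when
`f` is integrable with respect to the total variation of `μ`. -/
def cintegral (μ : ComplexMeasure Ω) (f : Ω → ℂ) : ℂ :=
  μ.integral f (ContinuousLinearMap.mul ℝ ℂ)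

theorem cintegral_add (μ ν : ComplexMeasure Ω) (f : Ω → ℂ) (hμ : Integrable f μ.variation)
    (hν : Integrable f ν.variation) :
    cintegral (μ + ν) f = cintegral μ f + cintegral ν f :=
  integral_add_vectorMeasure hμ hν

theorem cintegral_smul (c : ℂ) (μ : ComplexMeasure Ω) (f : Ω → ℂ) :
    cintegral (c • μ) f = c * cintegral μ f := by
  rcases eq_or_ne c 0 with rfl | hc
  · have h0 : (0 : ℂ) • μ = 0 := by
      ext X hX
      simp
    rw [h0, zero_mul]
    exact integral_zero_vectorMeasure
  have hv : (c • μ).variation = (‖c‖₊ : ℝ≥0∞) • μ.variation := variation_smul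
  have hint : Integrable f (c • μ).variation ↔ Integrable f μ.variation := by
    rw [hv]
    exact integrable_smul_measure (by simpa using hc) ENNReal.coe_ne_top
  by_cases hf : Integrable f μ.variation
  swap
  · rw [cintegral, cintegral, integral_undef hf, integral_undef (fun h => hf (hint.1 h)), mul_zero]
  have hT := dominatedFinMeasAdditive_cbmApplyMeasure μ (ContinuousLinearMap.mul ℝ ℂ)
  have hT' := dominatedFinMeasAdditive_cbmApplyMeasure (c • μ) (ContinuousLinearMap.mul ℝ ℂ)
  have hT2 := hT'
  rw [hv] at hT2
  have hTc := hT2.of_smul_measure ENNReal.coe_ne_top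
  have e1 : cintegral (c • μ) f = setToFun _ _ hTc f :=
    (setToFun_congr_measure_of_integrable _ ENNReal.coe_ne_top hv.le hTc hT' f hf).symm
  rw [e1]
  change _ = c * setToFun _ _ hT f
  refine hf.induction (P := fun g => setToFun _ _ hTc g = c * setToFun _ _ hT g) ?_ ?_ ?_ ?_
  · intro x s hs hμs
    rw [setToFun_indicator_const _ hs hμs.ne, setToFun_indicator_const _ hs hμs.ne]
    change x * (c • μ s) = c * (x * μ s)
    rw [smul_eq_mul]
    ring
  · intro g h _ hg hh eg eh
    rw [setToFun_add _ hg hh, setToFun_add _ hg hh, eg, eh, mul_add]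
  · exact isClosed_eq (continuous_setToFun hTc) (continuous_const.mul (continuous_setToFun hT))
  · intro g h hgh _ eg
    rw [← setToFun_congr_ae hTc hgh, ← setToFun_congr_ae hT hgh, eg]

end MeasureTheory.VectorMeasure

/-! ## Positive operator measures -/

/-- A positive operator valued measure on a Hilbert space `H`: a strongly `σ`-additive map from the
measurable sets to the positive bounded operators (by convention it is `0` on nonmeasurable sets).
It need not be normalized. -/
structure POVM (Ω : Type*) [MeasurableSpace Ω] (H : Type*) [NormedAddCommGroup H]
    [InnerProductSpace ℂ H] [CompleteSpace H] where
  toFun : Set Ω → H →L[ℂ] H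
  not_measurable' : ∀ X, ¬MeasurableSet X → toFun X = 0
  isPositive' : ∀ X, MeasurableSet X → (toFun X).IsPositive
  hasSum' : ∀ X : ℕ → Set Ω, (∀ n, MeasurableSet (X n)) → Pairwise (Function.onFun Disjoint X) →
    ∀ φ : H, HasSum (fun n => toFun (X n) φ) (toFun (⋃ n, X n) φ)

namespace POVM

variable {Ω : Type*} [MeasurableSpace Ω] {H : Type*} [NormedAddCommGroup H]
  [InnerProductSpace ℂ H] [CompleteSpace H]

theorem empty_apply (E : POVM Ω H) (φ : H) : E.toFun ∅ φ = 0 := by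
  have h := (E.hasSum' (fun _ => ∅) (fun _ => MeasurableSet.empty)
    (fun _ _ _ => disjoint_bot_left) φ).summable
  exact (summable_const_iff (β := ℕ) _).1 h

/-- The vector measure `E_φ : X ↦ E(X) φ`. -/
def vec (E : POVM Ω H) (φ : H) : VectorMeasure Ω H where
  measureOf' X := E.toFun X φ
  empty' := E.empty_apply φ
  not_measurable' X hX := by simp [E.not_measurable' X hX]
  m_iUnion' X hX hd := E.hasSum' X hX hd φ

/-- The complex measure `E_{ψ,φ} : X ↦ ⟪ψ, E(X) φ⟫`. -/
def scal (E : POVM Ω H) (ψ φ : H) : ComplexMeasure Ω where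
  measureOf' X := ⟪ψ, E.toFun X φ⟫_ℂ
  empty' := by simp [E.empty_apply φ]
  not_measurable' X hX := by simp [E.not_measurable' X hX]
  m_iUnion' X hX hd := (E.hasSum' X hX hd φ).mapL (innerSL ℂ ψ)

@[simp] theorem vec_apply (E : POVM Ω H) (φ : H) (X : Set Ω) : E.vec φ X = E.toFun X φ := rfl

@[simp] theorem scal_apply (E : POVM Ω H) (ψ φ : H) (X : Set Ω) :
    E.scal ψ φ X = ⟪ψ, E.toFun X φ⟫_ℂ := rfl

theorem isPositive (E : POVM Ω H) (X : Set Ω) : (E.toFun X).IsPositive := by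
  by_cases hX : MeasurableSet X
  · exact E.isPositive' X hX
  · rw [E.not_measurable' X hX]
    exact ContinuousLinearMap.isPositive_zero

theorem re_nonneg (E : POVM Ω H) (X : Set Ω) (φ : H) : 0 ≤ (⟪φ, E.toFun X φ⟫_ℂ).re :=
  (E.isPositive X).re_inner_nonneg_right φ

/-- The finite positive measure `E_{φ,φ} : X ↦ ⟪φ, E(X) φ⟫`. -/
def diag (E : POVM Ω H) (φ : H) : Measure Ω :=
  Measure.ofMeasurable (fun X _ => ENNReal.ofReal (⟪φ, E.toFun X φ⟫_ℂ).re)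
    (by simp [E.empty_apply φ])
    (by
      intro X hX hd
      have h := ((E.hasSum' X hX hd φ).mapL (innerSL ℂ φ)).mapL Complex.reCLM
      rw [← ENNReal.ofReal_tsum_of_nonneg (fun n => E.re_nonneg (X n) φ) h.summable]
      exact congrArg ENNReal.ofReal h.tsum_eq.symm)

theorem diag_apply (E : POVM Ω H) (φ : H) {X : Set Ω} (hX : MeasurableSet X) :
    E.diag φ X = ENNReal.ofReal (⟪φ, E.toFun X φ⟫_ℂ).re :=
  Measure.ofMeasurable_apply X hX

instance (E : POVM Ω H) (φ : H) : IsFiniteMeasure (E.diag φ) :=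
  ⟨by rw [E.diag_apply φ MeasurableSet.univ]; exact ENNReal.ofReal_lt_top⟩

theorem isSymm_apply (E : POVM Ω H) (X : Set Ω) (ψ φ : H) :
    ⟪ψ, E.toFun X φ⟫_ℂ = conj ⟪φ, E.toFun X ψ⟫_ℂ := by
  rw [inner_conj_symm]
  exact ((E.isPositive X).isSymmetric ψ φ).symm

theorem diag_add_le (E : POVM Ω H) (ψ φ : H) :
    E.diag (ψ + φ) ≤ (2 : ℝ≥0∞) • (E.diag ψ + E.diag φ) := by
  refine Measure.le_intro fun X hX _ => ?_
  have h := E.re_nonneg X (ψ - φ)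
  have h1 := E.re_nonneg X ψ
  have h2 := E.re_nonneg X φ
  simp only [Measure.smul_apply, Measure.add_apply, E.diag_apply _ hX, smul_eq_mul]
  rw [← ENNReal.ofReal_add h1 h2, ← ENNReal.ofReal_ofNat, ← ENNReal.ofReal_mul (by norm_num)]
  refine ENNReal.ofReal_le_ofReal ?_
  simp only [map_add, map_sub, inner_add_left, inner_add_right, inner_sub_left, inner_sub_right,
    Complex.add_re, Complex.sub_re] at h ⊢
  linarith

theorem diag_smul (E : POVM Ω H) (c : ℂ) (φ : H) :
    E.diag (c • φ) = ENNReal.ofReal (‖c‖ ^ 2) • E.diag φ := by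
  refine Measure.ext fun X hX => ?_
  simp only [Measure.smul_apply, E.diag_apply _ hX, smul_eq_mul]
  rw [← ENNReal.ofReal_mul (by positivity), map_smul, inner_smul_left, inner_smul_right,
    ← mul_assoc, Complex.conj_mul', ← Complex.ofReal_pow, Complex.re_ofReal_mul]

theorem variation_scal_le (E : POVM Ω H) (ψ φ : H) :
    (E.scal ψ φ).variation ≤ E.diag ψ + E.diag φ := by
  refine VectorMeasure.variation_le_of_forall_enorm_le fun X hX => ?_
  have h1 := E.re_nonneg X ψ
  have h2 := E.re_nonneg X φ
  rw [Measure.add_apply, E.diag_apply _ hX, E.diag_apply _ hX, ← ENNReal.ofReal_add h1 h2,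
    ← ofReal_norm]
  refine ENNReal.ofReal_le_ofReal ?_
  rw [scal_apply]
  set z : ℂ := ⟪ψ, E.toFun X φ⟫_ℂ with hz
  rcases eq_or_ne z 0 with h0 | h0
  · rw [h0, norm_zero]
    exact add_nonneg h1 h2
  have hn : ‖z‖ ≠ 0 := by simpa using h0
  obtain ⟨u, hu, huz⟩ : ∃ u : ℂ, conj u * u = 1 ∧ u * z = ‖z‖ := by
    have e1 : conj z * z = (‖z‖ : ℂ) ^ 2 := Complex.conj_mul' z
    have hn' : (‖z‖ : ℂ) ≠ 0 := by exact_mod_cast hn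
    refine ⟨conj z / ‖z‖, ?_, ?_⟩
    · simp only [map_div₀, Complex.conj_conj, Complex.conj_ofReal]
      field_simp
      rw [mul_comm, e1]
    · field_simp
      rw [e1]
  have h := E.re_nonneg X (ψ - u • φ)
  have hs : ⟪φ, E.toFun X ψ⟫_ℂ = conj z := E.isSymm_apply X φ ψ
  have e : ⟪ψ - u • φ, E.toFun X (ψ - u • φ)⟫_ℂ =
      ⟪ψ, E.toFun X ψ⟫_ℂ + ⟪φ, E.toFun X φ⟫_ℂ - ‖z‖ - ‖z‖ := by
    have huz' : conj u * conj z = ‖z‖ := by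
      rw [← map_mul, huz, Complex.conj_ofReal]
    simp only [map_sub, map_smul, inner_sub_left, inner_sub_right, inner_smul_left,
      inner_smul_right, hs, ← hz]
    linear_combination ⟪φ, E.toFun X φ⟫_ℂ * hu - huz - huz'
  rw [e] at h
  simp only [Complex.add_re, Complex.sub_re, Complex.ofReal_re] at h
  have : 0 ≤ ‖z‖ := norm_nonneg z
  linarith

/-- The set of pairs `(ψ, φ)` for which `f` is `E_{ψ,φ}`-integrable. -/
def formSet (E : POVM Ω H) (f : Ω → ℂ) : Set (H × H) :=
  {p | Integrable f (E.scal p.1 p.2).variation}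

/-- The form domain `{φ | ∫ |f| dE_{φ,φ} < ∞}`. -/
def formDomain (E : POVM Ω H) (f : Ω → ℂ) : Submodule ℂ H where
  carrier := {φ | ∫⁻ ω, ‖f ω‖ₑ ∂(E.diag φ) < ∞}
  zero_mem' := by
    have h : E.diag (0 : H) = 0 := by simpa using E.diag_smul 0 (0 : H)
    simp [h]
  add_mem' := by
    intro ψ φ hψ hφ
    refine (lintegral_mono' (E.diag_add_le ψ φ) le_rfl).trans_lt ?_
    rw [lintegral_smul_measure, lintegral_add_measure]
    exact ENNReal.mul_lt_top (by simp) (ENNReal.add_lt_top.2 ⟨hψ, hφ⟩)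
  smul_mem' := by
    intro c φ hφ
    change ∫⁻ ω, ‖f ω‖ₑ ∂(E.diag (c • φ)) < ∞
    rw [E.diag_smul, lintegral_smul_measure]
    exact ENNReal.mul_lt_top ENNReal.ofReal_lt_top hφ

theorem mem_formSet_of_mem_formDomain (E : POVM Ω H) {f : Ω → ℂ} (hf : Measurable f) {ψ φ : H}
    (hψ : ψ ∈ E.formDomain f) (hφ : φ ∈ E.formDomain f) : (ψ, φ) ∈ E.formSet f :=
  Integrable.mono_measure (ν := E.diag ψ + E.diag φ)
    ⟨hf.aestronglyMeasurable, by
      rw [HasFiniteIntegral, lintegral_add_measure]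
      exact ENNReal.add_lt_top.2 ⟨hψ, hφ⟩⟩ (E.variation_scal_le ψ φ)

/-- The sesquilinear form `(ψ, φ) ↦ ∫ f dE_{ψ,φ}` on a subspace `D` such that `f` is
`E_{ψ,φ}`-integrable for all `ψ, φ ∈ D`. -/
def formIntegralOn (E : POVM Ω H) (f : Ω → ℂ) (D : Submodule ℂ H)
    (hD : ∀ ψ ∈ D, ∀ φ ∈ D, (ψ, φ) ∈ E.formSet f) : FormOn D :=
  LinearMap.mk₂'ₛₗ (starRingEnd ℂ) (RingHom.id ℂ)
    (fun ψ φ : D => VectorMeasure.cintegral (E.scal ψ φ) f)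
    (fun a b φ => by
      rw [← VectorMeasure.cintegral_add _ _ _ (hD _ a.2 _ φ.2) (hD _ b.2 _ φ.2)]
      congr 1
      ext X hX
      simp)
    (fun c a φ => by
      rw [smul_eq_mul, ← VectorMeasure.cintegral_smul]
      congr 1
      ext X hX
      simp [mul_comm])
    (fun φ a b => by
      rw [← VectorMeasure.cintegral_add _ _ _ (hD _ φ.2 _ a.2) (hD _ φ.2 _ b.2)]
      congr 1
      ext X hX
      simp)
    (fun c φ a => by
      rw [RingHom.id_apply, smul_eq_mul, ← VectorMeasure.cintegral_smul]
      congr 1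
      ext X hX
      simp)

/-- The form integral of `f` with respect to `E`: the form `(ψ, φ) ↦ ∫ f dE_{ψ,φ}` on the form
domain. -/
def formIntegral (E : POVM Ω H) (f : Ω → ℂ) (hf : Measurable f) : FormOn (E.formDomain f) :=
  E.formIntegralOn f (E.formDomain f)
    fun _ hψ _ hφ => E.mem_formSet_of_mem_formDomain hf hψ hφ

/-- The symmetric weak operator integral of `f` determined by a dense subspace `D` such that `f` is
`E_{ψ,φ}`-integrable for all `ψ, φ ∈ D`: its domain is the set of `φ ∈ D` for which
`ψ ↦ ∫ f dE_{ψ,φ}` is continuous on `D`, and `⟪ψ, T φ⟫ = ∫ f dE_{ψ,φ}` for `ψ ∈ D`. -/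
def symmWeakIntegral (E : POVM Ω H) (f : Ω → ℂ) (D : Submodule ℂ H) (hdense : Dense (D : Set H))
    (hD : ∀ ψ ∈ D, ∀ φ ∈ D, (ψ, φ) ∈ E.formSet f) : H →ₗ.[ℂ] H :=
  (E.formIntegralOn f D hD).toOperator hdense

/-- The largest symmetric weak operator integral of `f`: the one determined by the form domain
(the largest subspace admissible in `symmWeakIntegral`). -/
def largestSymmWeakIntegral (E : POVM Ω H) (f : Ω → ℂ) (hf : Measurable f)
    (hdense : Dense (E.formDomain f : Set H)) : H →ₗ.[ℂ] H :=
  E.symmWeakIntegral f (E.formDomain f) hdense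
    fun _ hψ _ hφ => E.mem_formSet_of_mem_formDomain hf hψ hφ

/-- A spectral measure: a normalized projection valued POVM. -/
def IsSpectral (E : POVM Ω H) : Prop :=
  (∀ X, MeasurableSet X → E.toFun X ∘L E.toFun X = E.toFun X) ∧
    E.toFun Set.univ = ContinuousLinearMap.id ℂ H

/-- The domain `D(f, E)` of the strong operator integral: the set of `φ` for which `f` is integrable
with respect to the vector measure `E_φ`. -/
def strongDomain (E : POVM Ω H) (f : Ω → ℂ) : Set H :=
  {φ | ∃ ν, (E.vec φ).HasVectorIntegral f ν}

/-! ### The strong operator integral with respect to a spectral measure is linear -/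

section Spectral

variable {F : POVM Ω H}

theorem vec_union (x : H) {X Y : Set Ω} (hX : MeasurableSet X) (hY : MeasurableSet Y)
    (hd : Disjoint X Y) : F.toFun (X ∪ Y) x = F.toFun X x + F.toFun Y x :=
  (F.vec x).of_union hd hX hY

theorem IsSpectral.norm_sq (hF : F.IsSpectral) (x : H) {X : Set Ω} (hX : MeasurableSet X) :
    ‖F.toFun X x‖ ^ 2 = (⟪x, F.toFun X x⟫_ℂ).re := by
  have h := (F.isPositive X).isSymmetric x (F.toFun X x)
  have h2 : F.toFun X (F.toFun X x) = F.toFun X x := DFunLike.congr_fun (hF.1 X hX) x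
  simp only [ContinuousLinearMap.coe_coe] at h
  rw [h2] at h
  rw [← h, ← RCLike.re_to_complex, inner_self_eq_norm_sq]

theorem IsSpectral.enorm_sq (hF : F.IsSpectral) (x : H) {X : Set Ω} (hX : MeasurableSet X) :
    ‖F.toFun X x‖ₑ ^ 2 = F.diag x X := by
  rw [F.diag_apply x hX, ← hF.norm_sq x hX, ← ofReal_norm, ENNReal.ofReal_pow (norm_nonneg _)]

theorem IsSpectral.re_inner (hF : F.IsSpectral) (x : H) {X Y : Set Ω} (hX : MeasurableSet X)
    (hY : MeasurableSet Y) (hd : Disjoint X Y) : (⟪F.toFun X x, F.toFun Y x⟫_ℂ).re = 0 := by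
  have h := hF.norm_sq x (hX.union hY)
  rw [vec_union x hX hY hd, inner_add_right, Complex.add_re, ← hF.norm_sq x hX,
    ← hF.norm_sq x hY, @norm_add_sq ℂ, RCLike.re_to_complex] at h
  linarith

theorem IsSpectral.comp_apply (hF : F.IsSpectral) (x : H) {X Y : Set Ω} (hX : MeasurableSet X)
    (hY : MeasurableSet Y) (hd : Disjoint X Y) : F.toFun X (F.toFun Y x) = 0 := by
  have h := hF.re_inner (F.toFun Y x) hX hY hd
  have h2 : F.toFun Y (F.toFun Y x) = F.toFun Y x := DFunLike.congr_fun (hF.1 Y hY) x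
  have h3 := (F.isPositive X).isSymmetric (F.toFun Y x) (F.toFun Y x)
  simp only [ContinuousLinearMap.coe_coe] at h3
  rw [h2, h3, ← hF.norm_sq _ hX] at h
  simpa using h

theorem IsSpectral.inner_eq_zero (hF : F.IsSpectral) (x : H) {X Y : Set Ω} (hX : MeasurableSet X)
    (hY : MeasurableSet Y) (hd : Disjoint X Y) : ⟪F.toFun X x, F.toFun Y x⟫_ℂ = 0 := by
  have h3 := (F.isPositive X).isSymmetric x (F.toFun Y x)
  simp only [ContinuousLinearMap.coe_coe] at h3
  rw [h3, hF.comp_apply x hX hY hd, inner_zero_right]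

set_option linter.unusedSectionVars false in
theorem enorm_sq_sum_of_orthogonal {ι : Type*} (S : Finset ι) (v : ι → H)
    (hv : ∀ i j, i ≠ j → ⟪v i, v j⟫_ℂ = 0) : ‖∑ i ∈ S, v i‖ₑ ^ 2 = ∑ i ∈ S, ‖v i‖ₑ ^ 2 := by
  classical
  induction S using Finset.induction_on with
  | empty => simp
  | insert a S ha ih =>
    rw [Finset.sum_insert ha, Finset.sum_insert ha, ← ih]
    have h0 : ⟪v a, ∑ i ∈ S, v i⟫_ℂ = 0 := by
      rw [inner_sum]
      exact Finset.sum_eq_zero fun i hi => hv a i (fun h => ha (h ▸ hi))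
    have h := norm_add_sq_eq_norm_sq_add_norm_sq_of_inner_eq_zero _ _ h0
    simp only [← ofReal_norm, ← ENNReal.ofReal_pow (norm_nonneg _)]
    rw [← ENNReal.ofReal_add (by positivity) (by positivity)]
    congr 1
    nlinarith [h]

/-- The isometry property of the integral of simple functions. -/
theorem IsSpectral.enorm_simpleIntegral (hF : F.IsSpectral) (x : H) (s : SimpleFunc Ω ℂ)
    {X : Set Ω} (hX : MeasurableSet X) :
    ‖(F.vec x).simpleIntegral s X‖ₑ = eLpNorm s 2 ((F.diag x).restrict X) := by
  have hm : ∀ c, MeasurableSet (s ⁻¹' {c} ∩ X) := fun c => (s.measurableSet_fiber c).inter hX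
  have h1 : ‖(F.vec x).simpleIntegral s X‖ₑ ^ 2 = ∫⁻ ω, ‖s ω‖ₑ ^ 2 ∂((F.diag x).restrict X) := by
    rw [VectorMeasure.simpleIntegral, enorm_sq_sum_of_orthogonal]
    · have := SimpleFunc.lintegral_eq_lintegral (s.map fun c => ‖c‖ₑ ^ 2) ((F.diag x).restrict X)
      simp only [SimpleFunc.coe_map, Function.comp_apply] at this
      rw [this, SimpleFunc.map_lintegral]
      refine Finset.sum_congr rfl fun c _ => ?_
      rw [enorm_smul, mul_pow, vec_apply, hF.enorm_sq x (hm c),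
        Measure.restrict_apply (s.measurableSet_fiber c)]
    · intro a b hab
      rw [inner_smul_left, inner_smul_right, vec_apply, vec_apply,
        hF.inner_eq_zero x (hm a) (hm b), mul_zero, mul_zero]
      exact (Set.disjoint_left.2 fun ω h1 h2 => hab (h1.1.symm.trans h2.1))
  have h2 := eLpNorm_nnreal_pow_eq_lintegral (p := 2) (f := s) (μ := (F.diag x).restrict X)
    (by norm_num)
  simp only [NNReal.coe_ofNat, ENNReal.coe_ofNat, ENNReal.rpow_ofNat] at h2
  rw [← h2] at h1
  exact (ENNReal.pow_right_strictMono two_ne_zero).injective h1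

set_option linter.unusedSectionVars false in
theorem simpleIntegral_sub (μ : VectorMeasure Ω H) (s t : SimpleFunc Ω ℂ) {X : Set Ω}
    (hX : MeasurableSet X) :
    μ.simpleIntegral (s - t) X = μ.simpleIntegral s X - μ.simpleIntegral t X := by
  let T : Set Ω → ℂ →L[ℝ] H := fun Y => (ContinuousLinearMap.id ℝ ℂ).smulRight (μ (Y ∩ X))
  have hT : FinMeasAdditive (0 : Measure Ω) T := by
    intro a b ha hb _ _ hd
    ext c
    simp only [T, Set.union_inter_distrib_right]
    rw [μ.of_union (hd.mono Set.inter_subset_left Set.inter_subset_left) (ha.inter hX)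
      (hb.inter hX)]
    simp
  exact SimpleFunc.setToSimpleFunc_sub T hT integrable_zero_measure integrable_zero_measure

/-- The canonical approximation of a measurable function by simple functions. -/
def approx (f : Ω → ℂ) (hf : Measurable f) (n : ℕ) : SimpleFunc Ω ℂ :=
  SimpleFunc.approxOn f hf Set.univ 0 (Set.mem_univ 0) n

theorem tendsto_approx (f : Ω → ℂ) (hf : Measurable f) (ω : Ω) :
    Tendsto (fun n => approx f hf n ω) atTop (𝓝 (f ω)) :=
  SimpleFunc.tendsto_approxOn hf _ (by simp)

theorem tendsto_eLpNorm_approx (f : Ω → ℂ) (hf : Measurable f) (μ : Measure Ω)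
    (h : MemLp f 2 μ) : Tendsto (fun n => eLpNorm (⇑(approx f hf n) - f) 2 μ) atTop (𝓝 0) :=
  SimpleFunc.tendsto_approxOn_Lp_eLpNorm hf (Set.mem_univ 0) (by simp) (by simp)
    (by simpa using h.2)

theorem IsSpectral.tendsto_of_hasVectorIntegral (hF : F.IsSpectral) {x ν : H} {f : Ω → ℂ}
    (hf : Measurable f) (h : (F.vec x).HasVectorIntegral f ν) : MemLp f 2 (F.diag x) ∧
      Tendsto (fun n => (F.vec x).simpleIntegral (approx f hf n) Set.univ) atTop (𝓝 ν) := by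
  obtain ⟨s, hs, -, hν⟩ := h
  have hdist : ∀ a b : SimpleFunc Ω ℂ, edist ((F.vec x).simpleIntegral a Set.univ)
      ((F.vec x).simpleIntegral b Set.univ) = eLpNorm (⇑a - ⇑b) 2 (F.diag x) := by
    intro a b
    rw [edist_eq_enorm_sub, ← simpleIntegral_sub _ _ _ MeasurableSet.univ,
      hF.enorm_simpleIntegral x _ MeasurableSet.univ, Measure.restrict_univ, SimpleFunc.coe_sub]
  have hsf : Tendsto (fun n => eLpNorm (⇑(s n) - f) 2 (F.diag x)) atTop (𝓝 0) := by
    rw [ENNReal.tendsto_atTop_zero]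
    intro ε hε
    obtain ⟨N, hN⟩ := EMetric.cauchySeq_iff.1 hν.cauchySeq ε hε
    refine ⟨N, fun n hn => ?_⟩
    refine (Lp.eLpNorm_lim_le_liminf_eLpNorm (f := fun m => ⇑(s n) - ⇑(s m))
      (fun m => (s n - s m).aestronglyMeasurable) _
      (Eventually.of_forall fun ω => (hs ω).const_sub (s n ω))).trans ?_
    refine liminf_le_of_frequently_le' (Eventually.frequently ?_)
    filter_upwards [eventually_ge_atTop N] with m hm
    rw [← hdist]
    exact (hN n hn m hm).le
  have hmem : MemLp f 2 (F.diag x) := by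
    obtain ⟨n, hn⟩ := (hsf.eventually_lt_const (show (0 : ℝ≥0∞) < 1 by simp)).exists
    have h1 : MemLp (⇑(s n) - f) 2 (F.diag x) :=
      ⟨(s n).aestronglyMeasurable.sub hf.aestronglyMeasurable, hn.trans (by simp)⟩
    have h2 : MemLp (⇑(s n)) 2 (F.diag x) := (s n).memLp_of_isFiniteMeasure 2 _
    have := h2.sub h1
    simpa using this
  refine ⟨hmem, ?_⟩
  have h0 : Tendsto (fun n => edist ((F.vec x).simpleIntegral (approx f hf n) Set.univ)
      ((F.vec x).simpleIntegral (s n) Set.univ)) atTop (𝓝 0) := by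
    have hz := (tendsto_eLpNorm_approx f hf (F.diag x) hmem).add hsf
    rw [add_zero] at hz
    refine tendsto_of_tendsto_of_tendsto_of_le_of_le tendsto_const_nhds hz (fun _ => zero_le)
      fun n => ?_
    rw [hdist]
    have e : (⇑(approx f hf n) - ⇑(s n)) = (⇑(approx f hf n) - f) - (⇑(s n) - f) := by
      abel
    rw [e]
    exact eLpNorm_sub_le ((approx f hf n).aestronglyMeasurable.sub hf.aestronglyMeasurable)
      ((s n).aestronglyMeasurable.sub hf.aestronglyMeasurable) (by norm_num)
  rw [tendsto_iff_edist_tendsto_0] at hν ⊢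
  have hz := h0.add hν
  rw [add_zero] at hz
  exact tendsto_of_tendsto_of_tendsto_of_le_of_le tendsto_const_nhds hz (fun _ => zero_le)
    fun n => edist_triangle _ _ _

theorem IsSpectral.hasVectorIntegral_of_tendsto (hF : F.IsSpectral) {x ν : H} {f : Ω → ℂ}
    (hf : Measurable f) (hmem : MemLp f 2 (F.diag x))
    (h : Tendsto (fun n => (F.vec x).simpleIntegral (approx f hf n) Set.univ) atTop (𝓝 ν)) :
    (F.vec x).HasVectorIntegral f ν := by
  refine ⟨approx f hf, tendsto_approx f hf, fun X hX => ?_, h⟩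
  refine cauchySeq_tendsto_of_complete (EMetric.cauchySeq_iff.2 fun ε hε => ?_)
  have ht := tendsto_eLpNorm_approx f hf ((F.diag x).restrict X) (hmem.restrict X)
  obtain ⟨N, hN⟩ := eventually_atTop.1 (ht.eventually_lt_const (ENNReal.half_pos hε.ne'))
  refine ⟨N, fun m hm n hn => ?_⟩
  rw [edist_eq_enorm_sub, ← simpleIntegral_sub _ _ _ hX, hF.enorm_simpleIntegral x _ hX,
    SimpleFunc.coe_sub]
  have e : (⇑(approx f hf m) - ⇑(approx f hf n)) =
      (⇑(approx f hf m) - f) - (⇑(approx f hf n) - f) := by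
    abel
  rw [e]
  refine (eLpNorm_sub_le ((approx f hf m).aestronglyMeasurable.sub hf.aestronglyMeasurable)
    ((approx f hf n).aestronglyMeasurable.sub hf.aestronglyMeasurable) (by norm_num)).trans_lt ?_
  rw [← ENNReal.add_halves ε]
  exact ENNReal.add_lt_add (hN m hm) (hN n hn)

theorem IsSpectral.hasVectorIntegral_add (hF : F.IsSpectral) {x y ν η : H} {f : Ω → ℂ}
    (hf : Measurable f) (hx : (F.vec x).HasVectorIntegral f ν)
    (hy : (F.vec y).HasVectorIntegral f η) : (F.vec (x + y)).HasVectorIntegral f (ν + η) := by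
  obtain ⟨mx, tx⟩ := hF.tendsto_of_hasVectorIntegral hf hx
  obtain ⟨my, ty⟩ := hF.tendsto_of_hasVectorIntegral hf hy
  refine hF.hasVectorIntegral_of_tendsto hf ?_ ?_
  · refine MemLp.of_measure_le_smul (by simp) (F.diag_add_le x y) ⟨hf.aestronglyMeasurable, ?_⟩
    have h1 := (memLp_two_iff_integrable_sq_norm hf.aestronglyMeasurable).1 mx
    have h2 := (memLp_two_iff_integrable_sq_norm hf.aestronglyMeasurable).1 my
    exact ((memLp_two_iff_integrable_sq_norm hf.aestronglyMeasurable).2 (h1.add_measure h2)).2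
  · refine (tx.add ty).congr fun n => ?_
    simp [VectorMeasure.simpleIntegral, Finset.sum_add_distrib]

theorem IsSpectral.hasVectorIntegral_smul (hF : F.IsSpectral) {x ν : H} {f : Ω → ℂ} (c : ℂ)
    (hf : Measurable f) (hx : (F.vec x).HasVectorIntegral f ν) :
    (F.vec (c • x)).HasVectorIntegral f (c • ν) := by
  obtain ⟨mx, tx⟩ := hF.tendsto_of_hasVectorIntegral hf hx
  refine hF.hasVectorIntegral_of_tendsto hf ?_ ?_
  · rw [F.diag_smul]
    exact mx.smul_measure ENNReal.ofReal_ne_top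
  · refine (tx.const_smul c).congr fun n => ?_
    simp [VectorMeasure.simpleIntegral, Finset.smul_sum, smul_comm c]

theorem IsSpectral.hasVectorIntegral_unique (hF : F.IsSpectral) {x ν η : H} {f : Ω → ℂ}
    (hf : Measurable f) (hx : (F.vec x).HasVectorIntegral f ν)
    (hy : (F.vec x).HasVectorIntegral f η) : ν = η :=
  tendsto_nhds_unique (hF.tendsto_of_hasVectorIntegral hf hx).2
    (hF.tendsto_of_hasVectorIntegral hf hy).2

/-- The strong operator integral `L(f, F)` with respect to a spectral measure: its domain is
`D(f, F)`, and `L(f, F) x = ∫ f dF_x`. -/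
def strongIntegral (F : POVM Ω H) (hF : F.IsSpectral) (f : Ω → ℂ) (hf : Measurable f) :
    H →ₗ.[ℂ] H where
  domain :=
    { carrier := F.strongDomain f
      zero_mem' := ⟨0, hF.hasVectorIntegral_of_tendsto hf
        (by
          have h : F.diag (0 : H) = 0 := by simpa using F.diag_smul 0 (0 : H)
          simp [h])
        (by simp [VectorMeasure.simpleIntegral])⟩
      add_mem' := fun hx hy =>
        ⟨_, hF.hasVectorIntegral_add hf hx.choose_spec hy.choose_spec⟩
      smul_mem' := fun c _ hx => ⟨_, hF.hasVectorIntegral_smul c hf hx.choose_spec⟩ }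
  toFun :=
    { toFun := fun x => x.2.choose
      map_add' := fun x y => hF.hasVectorIntegral_unique hf (x + y).2.choose_spec
        (hF.hasVectorIntegral_add hf x.2.choose_spec y.2.choose_spec)
      map_smul' := fun c x => hF.hasVectorIntegral_unique hf (c • x).2.choose_spec
        (hF.hasVectorIntegral_smul c hf x.2.choose_spec) }

end Spectral

/-- `(K, F, V)`, with `F` a spectral measure in `K` and `V : H → K` bounded, is a Naimark dilation
of `E` if `E(X) = V* F(X) V` for all measurable `X`. -/
structure IsNaimarkDilation {K : Type*} [NormedAddCommGroup K] [InnerProductSpace ℂ K]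
    [CompleteSpace K] (E : POVM Ω H) (F : POVM Ω K) (V : H →L[ℂ] K) : Prop where
  isSpectral : F.IsSpectral
  eq_comp : ∀ X, MeasurableSet X → E.toFun X = V.adjoint ∘L F.toFun X ∘L V

end POVM

end

universe u v w

/-! On the diagonal, q(φ,φ) is the integral of f against the positive measure E_{φ,φ}. This is a
supremum of continuous functions of φ, hence lower semicontinuous on the whole of H, and this makes
q closed (`POVM.formIntegral_isClosed`). Symmetry and positivity also come from the diagonal, by
polarization.

For the representation theorem, closedness says that D with the inner product ⟪ψ,φ⟫ + q(ψ,φ) is a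
Hilbert space G, contractively embedded in H by j. Put R = j j*, so that 0 ≤ R ≤ 1, and B = √R, C =
√(1 - R). The operator S : B x ↦ C x is positive and selfadjoint, and S² = R⁻¹ - 1. Polar
decomposition of j shows that S has domain D and that q(ψ,φ) = ⟪Sψ, Sφ⟫
(`exists_sqrt_of_embedding`). No spectral theorem for unbounded operators is needed.

Uniqueness, the dilation formula and the weak integral all follow from
`FormOn.toOperator_eq_adjoint_natComp`: if A has domain D and q(ψ,φ) = ⟪Aψ, Aφ⟫, then A†A is the
operator that q determines weakly, whatever A is. With A = S it identifies every associated
operator; with A = L(√f, F)V it gives the dilation formula, since x ↦ L(√f, F)x has norm ‖√f‖ in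
L²(F_{x,x}) and F_{Vφ,Vφ} = E_{φ,φ}. -/

noncomputable section

/-! ### Polarization of sesquilinear forms. -/

section Sesquilinear

variable {D : Type*} [AddCommGroup D] [Module ℂ D]

/-- A sesquilinear form that vanishes on the diagonal is zero. -/
theorem sesquilinear_eq_zero_of_diag (b : D →ₗ⋆[ℂ] D →ₗ[ℂ] ℂ) (h : ∀ x, b x x = 0) (x y : D) :
    b x y = 0 := by
  -- The diagonal at x + y gives b(x,y) + b(y,x) = 0. At x + iy, antilinearity in the first slot
  -- gives i(b(x,y) - b(y,x)) = 0.
  have h1 := h (x + y)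
  have h2 := h (x + Complex.I • y)
  simp only [map_add, LinearMap.add_apply, map_smulₛₗ, LinearMap.smul_apply, h, zero_add,
    add_zero, smul_eq_mul, RingHom.id_apply, Complex.conj_I, mul_zero] at h1 h2
  linear_combination (h1 - Complex.I * h2) / 2 + (b x y - b y x) / 2 * Complex.I_mul_I

/-- A sesquilinear form is determined by its diagonal. -/
theorem sesquilinear_eq_inner_of_diag {K : Type*} [NormedAddCommGroup K] [InnerProductSpace ℂ K]
    (q : D →ₗ⋆[ℂ] D →ₗ[ℂ] ℂ) (A : D →ₗ[ℂ] K) (h : ∀ x, q x x = ⟪A x, A x⟫_ℂ) (x y : D) :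
    q x y = ⟪A x, A y⟫_ℂ := by
  let b : D →ₗ⋆[ℂ] D →ₗ[ℂ] ℂ := LinearMap.mk₂'ₛₗ (starRingEnd ℂ) (RingHom.id ℂ)
    (fun x y => ⟪A x, A y⟫_ℂ) (fun x y z => by rw [map_add, inner_add_left])
    (fun c x y => by rw [map_smul, inner_smul_left, smul_eq_mul])
    (fun x y z => by rw [map_add, inner_add_right])
    (fun c x y => by rw [map_smul, inner_smul_right, smul_eq_mul, RingHom.id_apply])
  exact sub_eq_zero.1 (sesquilinear_eq_zero_of_diag (q - b) (fun x => sub_eq_zero.2 (h x)) x y)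

/-- A sesquilinear form that is real on the diagonal is hermitian. -/
theorem sesquilinear_symm_of_diag_im (b : D →ₗ⋆[ℂ] D →ₗ[ℂ] ℂ) (h : ∀ x, (b x x).im = 0)
    (x y : D) : b x y = conj (b y x) := by
  have h1 := h (x + y)
  have h2 := h (x + Complex.I • y)
  simp only [map_add, LinearMap.add_apply, map_smulₛₗ, LinearMap.smul_apply, h, zero_add,
    smul_eq_mul, RingHom.id_apply, Complex.conj_I, Complex.add_im, Complex.add_re, Complex.mul_im,
    Complex.I_re, Complex.I_im, Complex.neg_re, Complex.neg_im, zero_mul, one_mul,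
    Complex.mul_re, neg_mul, mul_zero, add_zero, sub_zero, neg_zero] at h1 h2
  apply Complex.ext
  · simp only [Complex.conj_re]; linarith
  · simp only [Complex.conj_im]; linarith

end Sesquilinear

/-! ### Unbounded operators P x ↦ Q x built from bounded commuting pairs. -/

section OfPair

variable {H : Type*} [NormedAddCommGroup H] [InnerProductSpace ℂ H]

/-- The partially defined operator `P x ↦ Q x` on the range of an injective operator `P`. -/
def LinearPMap.ofPair (P Q : H →L[ℂ] H) (hP : Function.Injective P) : H →ₗ.[ℂ] H where
  domain := (P : H →ₗ[ℂ] H).range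
  toFun := (Q : H →ₗ[ℂ] H) ∘ₗ
    (LinearEquiv.ofInjective (P : H →ₗ[ℂ] H) hP).symm.toLinearMap

theorem LinearPMap.ofPair_apply {P Q : H →L[ℂ] H} (hP : Function.Injective P) (x : H)
    (h : P x ∈ (LinearPMap.ofPair P Q hP).domain) : LinearPMap.ofPair P Q hP ⟨P x, h⟩ = Q x := by
  change Q ((LinearEquiv.ofInjective (P : H →ₗ[ℂ] H) hP).symm ⟨P x, h⟩) = Q x
  congr 1
  exact (LinearEquiv.symm_apply_eq _).2 rfl

/-- The square of `B x ↦ C x` is `B² x ↦ C² x` if `B` and `C` commute and `B² + C² = 1`. -/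
theorem LinearPMap.ofPair_natComp_self {B C : H →L[ℂ] H} (hB : Function.Injective B)
    (hBB : Function.Injective (B * B)) (hBC : Commute B C) (h1 : B * B + C * C = 1) :
    (LinearPMap.ofPair B C hB).natComp (LinearPMap.ofPair B C hB) =
      LinearPMap.ofPair (B * B) (C * C) hBB := by
  have c : ∀ x, B (C x) = C (B x) := fun x => DFunLike.congr_fun hBC.eq x
  have hone : ∀ x, B (B x) + C (C x) = x := fun x => DFunLike.congr_fun h1 x
  have hle : LinearPMap.ofPair (B * B) (C * C) hBB ≤
      (LinearPMap.ofPair B C hB).natComp (LinearPMap.ofPair B C hB) := by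
    refine LinearPMap.le_of_le_graph fun p hp => ?_
    rw [LinearPMap.mem_graph_iff] at hp ⊢
    obtain ⟨⟨_, x, rfl⟩, hy1, hy2⟩ := hp
    have e : LinearPMap.ofPair B C hB ⟨B (B x), _, rfl⟩ = C (B x) := ofPair_apply hB _ _
    have e' : LinearPMap.ofPair B C hB ⟨B (B x), _, rfl⟩ = B (C x) := e.trans (c x).symm
    have hm : B (B x) ∈ ((LinearPMap.ofPair B C hB).natComp (LinearPMap.ofPair B C hB)).domain :=
      mem_natComp_domain.2 ⟨⟨_, rfl⟩, e' ▸ ⟨C x, rfl⟩⟩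
    refine ⟨⟨B (B x), hm⟩, hy1, ?_⟩
    have h2 : LinearPMap.ofPair (B * B) (C * C) hBB ⟨_, ⟨x, rfl⟩⟩ = (C * C) x :=
      ofPair_apply hBB _ _
    refine Eq.trans ?_ (h2.symm.trans hy2)
    have h3 : LinearPMap.ofPair B C hB ⟨B (C x), _, rfl⟩ = C (C x) := ofPair_apply hB _ _
    refine Eq.trans ?_ h3
    change LinearPMap.ofPair B C hB ⟨LinearPMap.ofPair B C hB ⟨B (B x), _⟩, _⟩ = _
    congr 1
    exact Subtype.ext e'
  refine (LinearPMap.eq_of_le_of_domain_eq hle (le_antisymm hle.1 fun x hx => ?_)).symm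
  obtain ⟨⟨y, rfl⟩, z, hz⟩ := mem_natComp_domain.1 hx
  have hz' : B z = C y := hz.trans (ofPair_apply hB y _)
  -- Since B z = C y, the relation B² + C² = 1 gives B(B y + C z) = B²y + C²y = y.
  refine ⟨B y + C z, ?_⟩
  change B (B (B y + C z)) = B y
  rw [_root_.map_add, c z, hz', hone]

variable [CompleteSpace H]

theorem denseRange_of_isSelfAdjoint_of_injective {P : H →L[ℂ] H} (hP : IsSelfAdjoint P)
    (hi : Function.Injective P) : DenseRange P := by
  have h := ContinuousLinearMap.orthogonal_range P
  rw [hP.adjoint_eq, LinearMap.ker_eq_bot.2 hi] at h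
  have := (Submodule.dense_iff_topologicalClosure_eq_top (s := P.range)).2
    ((Submodule.topologicalClosure_eq_top_iff).2 h)
  exact this

theorem inner_apply_left_of_isSelfAdjoint {P : H →L[ℂ] H} (hP : IsSelfAdjoint P) (x y : H) :
    ⟪P x, y⟫_ℂ = ⟪x, P y⟫_ℂ := by
  conv_lhs => rw [← hP.adjoint_eq, ContinuousLinearMap.adjoint_inner_left]

/-- M and N act as Bézout coefficients. A pair (y, w) in the graph of the adjoint satisfies P w = Q
y, and then u = M y + N w satisfies P u = y and Q u = w, so the pair already lies in the graph of
the operator. The uses are M = P = B, N = Q = C for the root, and M = N = 1 for its square. -/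
theorem LinearPMap.ofPair_isPositiveSelfAdjoint {P Q M N : H →L[ℂ] H}
    (hi : Function.Injective P) (hP : IsSelfAdjoint P) (hQ : IsSelfAdjoint Q)
    (hPQ : Commute P Q) (hPM : Commute P M) (hPN : Commute P N) (hQM : Commute Q M)
    (hQN : Commute Q N) (h1 : M * P + N * Q = 1) (hpos : 0 ≤ P * Q) :
    IsPositiveSelfAdjoint (LinearPMap.ofPair P Q hi) := by
  have c : ∀ {A B : H →L[ℂ] H}, Commute A B → ∀ x, A (B x) = B (A x) := fun h x =>
    DFunLike.congr_fun h.eq x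
  have hdense : Dense ((LinearPMap.ofPair P Q hi).domain : Set H) :=
    denseRange_of_isSelfAdjoint_of_injective hP hi
  have hone : ∀ x, M (P x) + N (Q x) = x := fun x => DFunLike.congr_fun h1 x
  have hform : (LinearPMap.ofPair P Q hi).IsFormalAdjoint (LinearPMap.ofPair P Q hi) := by
    rintro ⟨_, x, rfl⟩ ⟨_, y, rfl⟩
    refine (congrArg₂ _ (ofPair_apply hi x _) rfl).trans
      (Eq.trans ?_ (congrArg₂ _ rfl (ofPair_apply hi y _).symm))
    change ⟪Q x, P y⟫_ℂ = ⟪P x, Q y⟫_ℂ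
    rw [inner_apply_left_of_isSelfAdjoint hQ, inner_apply_left_of_isSelfAdjoint hP, c hPQ]
  refine ⟨?_, ?_⟩
  · refine LinearPMap.isSelfAdjoint_def.2 (le_antisymm ?_ (hform.le_adjoint hdense))
    refine LinearPMap.le_of_le_graph fun p hp => ?_
    rw [LinearPMap.mem_graph_iff] at hp ⊢
    obtain ⟨y, hy1, hy2⟩ := hp
    set w := p.2
    have key : P w = Q y := by
      refine ext_inner_right ℂ fun x => ?_
      have h := LinearPMap.adjoint_isFormalAdjoint hdense y ⟨P x, x, rfl⟩
      rw [hy2] at h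
      rw [inner_apply_left_of_isSelfAdjoint hP, inner_apply_left_of_isSelfAdjoint hQ]
      exact h.trans (congrArg₂ _ rfl (ofPair_apply hi x _))
    have e1 : P (M y + N w) = p.1 := by
      rw [_root_.map_add, c hPM, c hPN, key, hone, hy1]
    have e2 : Q (M y + N w) = w := by
      rw [_root_.map_add, c hQM, c hQN, ← key, hone]
    exact ⟨⟨P (M y + N w), _, rfl⟩, e1, (ofPair_apply hi _ _).trans e2⟩
  · rintro ⟨_, x, rfl⟩
    have e : (LinearPMap.ofPair P Q hi) ⟨P x, x, rfl⟩ = Q x := ofPair_apply hi x _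
    refine le_of_le_of_eq ?_ (congrArg (fun z => (⟪P x, z⟫_ℂ).re) e.symm)
    rw [inner_apply_left_of_isSelfAdjoint hP]
    exact ((ContinuousLinearMap.nonneg_iff_isPositive _).1 hpos).re_inner_nonneg_right x

end OfPair

/-! ### The positive square root attached to a contractive embedding. -/

section Embedding

variable {H G : Type*} [NormedAddCommGroup H] [InnerProductSpace ℂ H] [CompleteSpace H]
  [NormedAddCommGroup G] [InnerProductSpace ℂ G] [CompleteSpace G]

/-- An injective bounded operator `j` with dense range equals `√(j j*)` up to a unitary. -/
theorem exists_unitary_comp_sqrt (j : G →L[ℂ] H) (hj : Function.Injective j) {B : H →L[ℂ] H}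
    (hB : IsSelfAdjoint B) (hBi : Function.Injective B)
    (hBB : B * B = j ∘L j.adjoint) :
    ∃ W : H ≃ₗᵢ[ℂ] G, ∀ x, j (W x) = B x := by
  have hd : DenseRange (B : H →ₗ[ℂ] H) := denseRange_of_isSelfAdjoint_of_injective hB hBi
  have hBB' : ∀ x, B (B x) = j (j.adjoint x) := fun x => DFunLike.congr_fun hBB x
  have hn : ∀ x, ‖j.adjoint x‖ = ‖B x‖ := fun x => by
    have : ⟪j.adjoint x, j.adjoint x⟫_ℂ = ⟪B x, B x⟫_ℂ := by
      rw [ContinuousLinearMap.adjoint_inner_left, ← hBB',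
        ← inner_apply_left_of_isSelfAdjoint hB]
    rw [inner_self_eq_norm_sq_to_K, inner_self_eq_norm_sq_to_K] at this
    have h2 : ‖j.adjoint x‖ ^ 2 = ‖B x‖ ^ 2 := by exact_mod_cast this
    exact (pow_left_inj₀ (norm_nonneg _) (norm_nonneg _) two_ne_zero).1 h2
  -- Since ‖j*x‖ = ‖B x‖ and B has dense range, B x ↦ j*x extends to an isometry on all of H.
  let W : H →L[ℂ] G := (j.adjoint : H →ₗ[ℂ] G).extendOfNorm (B : H →ₗ[ℂ] H)
  have hW : ∀ x, W (B x) = j.adjoint x :=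
    LinearMap.extendOfNorm_eq hd ⟨1, fun x => by rw [one_mul]; exact (hn x).le⟩
  have hWn : ∀ x, ‖W x‖ = ‖x‖ := fun x => by
    refine hd.induction_on x (isClosed_eq W.continuous.norm continuous_norm) fun y => ?_
    change ‖W (B y)‖ = ‖B y‖
    rw [hW, hn]
  have hjW : ∀ x, j (W x) = B x := fun x => by
    refine hd.induction_on x (isClosed_eq (j.continuous.comp W.continuous) B.continuous)
      fun y => ?_
    change j (W (B y)) = B (B y)
    rw [hW, hBB']
  let Wi : H →ₗᵢ[ℂ] G := ⟨W, hWn⟩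
  -- The range of an isometry is closed. It contains the range of j*, which is dense because j is
  -- injective.
  have hsurj : Function.Surjective Wi := by
    have hcl : IsClosed (Set.range Wi) := Wi.isometry.isClosedEmbedding.isClosed_range
    have hdW : Dense (Set.range Wi) := by
      have h := ContinuousLinearMap.orthogonal_range j.adjoint
      rw [ContinuousLinearMap.adjoint_adjoint, LinearMap.ker_eq_bot.2 hj] at h
      have h3 : Dense (j.adjoint.range : Set G) :=
        (Submodule.dense_iff_topologicalClosure_eq_top).2
          ((Submodule.topologicalClosure_eq_top_iff).2 h)
      refine h3.mono ?_
      rintro _ ⟨x, rfl⟩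
      exact ⟨B x, hW x⟩
    intro g
    have : g ∈ closure (Set.range Wi) := hdW g
    rwa [hcl.closure_eq] at this
  exact ⟨LinearIsometryEquiv.ofSurjective Wi hsurj, hjW⟩

/-- S is formally √(R⁻¹ - 1) with R = j j*, realized as B x ↦ C x for the bounded roots B = √R and C
= √(1 - R). With a unitary W such that j W = B, the range of j is the range of B, and the last
identity is ⟪Cx, Cy⟫ = ⟪x, y⟫ - ⟪Bx, By⟫ transported by W. -/
theorem exists_sqrt_of_embedding (j : G →L[ℂ] H) (hj : Function.Injective j)
    (hd : DenseRange j) (hle : ∀ x, ‖j x‖ ≤ ‖x‖) :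
    ∃ S : H →ₗ.[ℂ] H, IsPositiveSelfAdjoint S ∧ IsPositiveSelfAdjoint (S.natComp S) ∧
      (∀ x, x ∈ S.domain ↔ ∃ g, j g = x) ∧
      ∀ (g g' : G) (h : j g ∈ S.domain) (h' : j g' ∈ S.domain),
        ⟪S ⟨j g, h⟩, S ⟨j g', h'⟩⟫_ℂ = ⟪g, g'⟫_ℂ - ⟪j g, j g'⟫_ℂ := by
  set R : H →L[ℂ] H := j ∘L j.adjoint with hR
  have hRpos : 0 ≤ R := (ContinuousLinearMap.nonneg_iff_isPositive _).2
    (ContinuousLinearMap.isPositive_self_comp_adjoint j)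
  have hjn : ‖j.adjoint‖ ≤ 1 := by
    rw [LinearIsometryEquiv.norm_map]
    exact j.opNorm_le_bound zero_le_one fun x => by rw [one_mul]; exact hle x
  have hR1 : 0 ≤ 1 - R := by
    refine (ContinuousLinearMap.nonneg_iff_isPositive _).2
      ((ContinuousLinearMap.isPositive_iff_complex _).2 fun x => ?_)
    have e : ⟪(1 - R) x, x⟫_ℂ = ((‖x‖ ^ 2 - ‖j.adjoint x‖ ^ 2 : ℝ) : ℂ) := by
      have : ⟪R x, x⟫_ℂ = ⟪j.adjoint x, j.adjoint x⟫_ℂ := by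
        rw [ContinuousLinearMap.adjoint_inner_right]; rfl
      rw [sub_apply, inner_sub_left, this]
      change ⟪x, x⟫_ℂ - _ = _
      rw [inner_self_eq_norm_sq_to_K, inner_self_eq_norm_sq_to_K]
      push_cast
      rfl
    have hn : ‖j.adjoint x‖ ≤ ‖x‖ := by
      simpa using (j.adjoint.le_of_opNorm_le hjn x)
    rw [e]
    refine ⟨by rw [RCLike.re_to_complex, Complex.ofReal_re], ?_⟩
    simp only [RCLike.re_to_complex, Complex.ofReal_re]
    nlinarith [norm_nonneg (j.adjoint x), norm_nonneg x]
  set B := CFC.sqrt R with hBdef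
  set C := CFC.sqrt (1 - R) with hCdef
  have hBB : B * B = R := CFC.sqrt_mul_sqrt_self R
  have hCC : C * C = 1 - R := CFC.sqrt_mul_sqrt_self (1 - R)
  have hB0 : 0 ≤ B := CFC.sqrt_nonneg R
  have hC0 : 0 ≤ C := CFC.sqrt_nonneg (1 - R)
  have hBC : Commute B C := by
    have h1 : Commute R (1 - R) := (Commute.one_right R).sub_right (Commute.refl R)
    rw [hBdef, hCdef, CFC.sqrt_eq_real_sqrt R, CFC.sqrt_eq_real_sqrt (1 - R)]
    exact ((h1.cfcₙ_real _).symm.cfcₙ_real _).symm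
  have hsum : B * B + C * C = 1 := by rw [hBB, hCC]; abel
  have hRi : Function.Injective R := by
    refine (injective_iff_map_eq_zero R).2 fun x hx => ?_
    have h1 : j.adjoint x = 0 := hj (by rw [map_zero]; exact hx)
    refine Dense.eq_zero_of_inner_left ℂ hd ?_
    rintro _ ⟨g, rfl⟩
    rw [← ContinuousLinearMap.adjoint_inner_left, h1, inner_zero_left]
  have hBi : Function.Injective B := by
    refine (injective_iff_map_eq_zero B).2 fun x hx => hRi ?_
    rw [← hBB, map_zero]
    change B (B x) = 0
    rw [hx, map_zero]
  have hBBi : Function.Injective (B * B) := hBB ▸ hRi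
  have hBs : IsSelfAdjoint B := IsSelfAdjoint.of_nonneg hB0
  have hCs : IsSelfAdjoint C := IsSelfAdjoint.of_nonneg hC0
  obtain ⟨W, hW⟩ := exists_unitary_comp_sqrt j hj hBs hBi hBB
  have hdom : ∀ x, x ∈ (LinearPMap.ofPair B C hBi).domain ↔ ∃ g, j g = x := fun x =>
    ⟨fun ⟨y, hy⟩ => ⟨W y, (hW y).trans hy⟩, fun ⟨g, hg⟩ => ⟨W.symm g, by
      rw [← hg]
      exact (hW _).symm.trans (by rw [W.apply_symm_apply])⟩⟩
  have key : ∀ (x y : H) (h : B x ∈ (LinearPMap.ofPair B C hBi).domain)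
      (h' : B y ∈ (LinearPMap.ofPair B C hBi).domain), ⟪LinearPMap.ofPair B C hBi ⟨B x, h⟩,
      LinearPMap.ofPair B C hBi ⟨B y, h'⟩⟫_ℂ = ⟪x, y⟫_ℂ - ⟪B x, B y⟫_ℂ := fun x y h h' => by
    rw [LinearPMap.ofPair_apply, LinearPMap.ofPair_apply,
      inner_apply_left_of_isSelfAdjoint hCs, inner_apply_left_of_isSelfAdjoint hBs,
      ← inner_sub_right]
    congr 1
    exact eq_sub_of_add_eq' (DFunLike.congr_fun hsum y)
  refine ⟨LinearPMap.ofPair B C hBi, ?_, ?_, hdom, ?_⟩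
  · exact LinearPMap.ofPair_isPositiveSelfAdjoint hBi hBs hCs hBC (Commute.refl B) hBC hBC.symm
      (Commute.refl C) hsum (hBC.mul_nonneg hB0 hC0)
  · rw [LinearPMap.ofPair_natComp_self hBi hBBi hBC hsum]
    have hc : Commute (B * B) (C * C) := (hBC.mul_right hBC).mul_left (hBC.mul_right hBC)
    refine LinearPMap.ofPair_isPositiveSelfAdjoint (M := 1) (N := 1) hBBi ?_ ?_ hc
      (Commute.one_right _) (Commute.one_right _) (Commute.one_right _) (Commute.one_right _)
      (by rw [one_mul, one_mul, hsum]) (hc.mul_nonneg ?_ ?_)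
    · rw [hBB]; exact IsSelfAdjoint.of_nonneg hRpos
    · rw [hCC]; exact IsSelfAdjoint.of_nonneg hR1
    · rwa [hBB]
    · rwa [hCC]
  · intro g g' h h'
    obtain ⟨x, rfl⟩ := W.surjective g
    obtain ⟨y, rfl⟩ := W.surjective g'
    simp only [hW] at h h' ⊢
    rw [key, W.inner_map_map]

end Embedding

end

/-! ### The representation theorem for closed positive forms. -/

noncomputable section

namespace FormOn

variable {H : Type*} [NormedAddCommGroup H] [InnerProductSpace ℂ H] {D : Submodule ℂ H}

theorem toOperator_congr_apply [CompleteSpace H] (q : FormOn D) (hD : Dense (D : Set H))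
    (φ : (q.toOperator hD).domain) (ψ φ' : D) (h : (φ' : H) = φ) :
    ⟪(ψ : H), q.toOperator hD φ⟫_ℂ = q ψ φ' := by
  rw [inner_toOperator]
  congr 1
  exact Subtype.ext h.symm

/-- The operator determined by the form `⟪A ψ, A φ⟫` is `A† A`. -/
theorem toOperator_eq_adjoint_natComp [CompleteSpace H] {K : Type*} [NormedAddCommGroup K]
    [InnerProductSpace ℂ K] (q : FormOn D) (hD : Dense (D : Set H)) (A : H →ₗ.[ℂ] K)
    (hA : A.domain = D) (hq : ∀ ψ φ : D,
      q ψ φ = ⟪A ⟨ψ, hA.symm ▸ ψ.2⟩, A ⟨φ, hA.symm ▸ φ.2⟩⟫_ℂ) :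
    q.toOperator hD = A.adjoint.natComp A := by
  subst hA
  have hle : q.toOperator hD ≤ A.adjoint.natComp A := by
    refine LinearPMap.le_of_le_graph fun p hp => ?_
    rw [LinearPMap.mem_graph_iff] at hp ⊢
    obtain ⟨φ, hy1, hy2⟩ := hp
    have hφ : (φ : H) ∈ A.domain := φ.2.choose
    -- The vector assigned to φ by the form represents x ↦ ⟪Aφ, Ax⟫, so it is A†(Aφ).
    have hw : ∀ x : A.domain, ⟪q.toOperator hD φ, (x : H)⟫_ℂ = ⟪A ⟨φ, hφ⟩, A x⟫_ℂ := fun x => by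
      rw [← inner_conj_symm, q.toOperator_congr_apply hD φ x ⟨φ, hφ⟩ rfl, hq, inner_conj_symm]
    have hm : A ⟨φ, hφ⟩ ∈ A.adjoint.domain := A.mem_adjoint_domain_of_exists _ ⟨_, hw⟩
    refine ⟨⟨φ, LinearPMap.mem_natComp_domain.2 ⟨hφ, hm⟩⟩, hy1, ?_⟩
    rw [← hy2]
    exact LinearPMap.adjoint_apply_eq hD ⟨_, hm⟩ hw
  refine LinearPMap.eq_of_le_of_domain_eq hle (le_antisymm hle.1 fun x hx => ?_)
  obtain ⟨hx1, hx2⟩ := LinearPMap.mem_natComp_domain.1 hx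
  refine ⟨hx1, ?_⟩
  -- Aφ lies in the domain of A† exactly when ψ ↦ ⟪Aφ, Aψ⟫ is continuous; its conjugate is ψ ↦
  -- q(ψ,φ).
  have hc := Complex.continuous_conj.comp ((A.mem_adjoint_domain_iff _).1 hx2)
  refine hc.congr fun ψ => ?_
  rw [hq]
  exact inner_conj_symm _ _

/-- As S is selfadjoint, S S = S†S, which depends on q alone. This is the uniqueness of the
associated operator. -/
theorem eq_toOperator_of_isAssociated [CompleteSpace H] (q : FormOn D) (hD : Dense (D : Set H))
    {T : H →ₗ.[ℂ] H} (hT : q.IsAssociated T) : T = q.toOperator hD := by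
  obtain ⟨-, S, hS, rfl, hdom, hq⟩ := hT
  rw [q.toOperator_eq_adjoint_natComp hD S hdom hq, LinearPMap.isSelfAdjoint_def.1 hS.1]

/-- The domain of a form, to be normed by `‖φ‖² + q(φ, φ)`. -/
def FormSpace (D : Submodule ℂ H) : Type _ := D

instance : AddCommGroup (FormSpace D) := inferInstanceAs (AddCommGroup D)

instance : Module ℂ (FormSpace D) := inferInstanceAs (Module ℂ D)

/-- The inclusion of the form domain in the Hilbert space. -/
def FormSpace.incl (D : Submodule ℂ H) : FormSpace D →ₗ[ℂ] H := D.subtype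

/-- The inner product `⟪ψ, φ⟫ + q(ψ, φ)` on the domain of a positive form. -/
@[reducible] def core (q : FormOn D) (hs : q.IsSymm) (hp : q.IsPos) :
    InnerProductSpace.Core ℂ (FormSpace D) where
  inner ψ φ := ⟪FormSpace.incl D ψ, FormSpace.incl D φ⟫_ℂ + q ψ φ
  conj_inner_symm ψ φ := by
    rw [map_add, inner_conj_symm]
    congr 1
    exact (hs ψ φ).symm
  re_inner_nonneg φ := by
    rw [map_add]
    exact add_nonneg inner_self_nonneg (hp φ).1
  add_left ψ φ χ := by
    have h : q (ψ + φ : D) χ = q ψ χ + q φ χ :=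
      LinearMap.congr_fun (q.map_add ψ φ) χ
    rw [map_add, inner_add_left]
    refine (congrArg _ h).trans ?_
    ring
  smul_left ψ φ r := by
    have h : q (r • ψ : D) φ = conj r * q ψ φ :=
      LinearMap.congr_fun (q.map_smulₛₗ r ψ) φ
    rw [map_smul, inner_smul_left]
    refine (congrArg _ h).trans ?_
    ring
  definite φ h := by
    have h1 := congrArg Complex.re h
    have h2 : 0 ≤ (⟪FormSpace.incl D φ, FormSpace.incl D φ⟫_ℂ).re :=
      inner_self_nonneg (𝕜 := ℂ)
    have h3 : (⟪FormSpace.incl D φ, FormSpace.incl D φ⟫_ℂ).re + (q φ φ).re = 0 := h1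
    have h4 : (⟪FormSpace.incl D φ, FormSpace.incl D φ⟫_ℂ).re = 0 := by
      linarith [(hp φ).1]
    have h5 : FormSpace.incl D φ = 0 := by
      rw [← inner_self_eq_zero (𝕜 := ℂ), ← inner_self_ofReal_re, RCLike.re_to_complex, h4]
      rfl
    exact Subtype.ext h5

/-- A densely defined closed positive form is `⟪S ψ, S φ⟫` with `S` positive and selfadjoint. -/
theorem exists_sqrt [CompleteSpace H] (q : FormOn D) (hD : Dense (D : Set H)) (hs : q.IsSymm)
    (hp : q.IsPos) (hc : q.IsClosed) :
    ∃ S : H →ₗ.[ℂ] H, IsPositiveSelfAdjoint S ∧ IsPositiveSelfAdjoint (S.natComp S) ∧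
      ∃ hS : S.domain = D, ∀ ψ φ : D,
        q ψ φ = ⟪S ⟨ψ, hS.symm ▸ ψ.2⟩, S ⟨φ, hS.symm ▸ φ.2⟩⟫_ℂ := by
  -- `FormSpace D` is a separate type so that this norm does not clash with the one `D` inherits
  -- from H.
  let c := q.core hs hp
  let : NormedAddCommGroup (FormSpace D) := c.toNormedAddCommGroup
  let : InnerProductSpace ℂ (FormSpace D) := InnerProductSpace.ofCore c.toCore
  have hinner : ∀ ψ φ : FormSpace D,
      ⟪ψ, φ⟫_ℂ = ⟪FormSpace.incl D ψ, FormSpace.incl D φ⟫_ℂ + q ψ φ := fun _ _ => rfl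
  have hq : ∀ φ : D, q φ φ = ((q φ φ).re : ℂ) := fun φ => Complex.ext rfl (hp φ).2
  have hnorm : ∀ φ : FormSpace D, ‖φ‖ ^ 2 = ‖FormSpace.incl D φ‖ ^ 2 + (q φ φ).re := fun φ => by
    have h := congrArg Complex.re (hinner φ φ)
    rw [inner_self_eq_norm_sq_to_K, Complex.add_re, inner_self_eq_norm_sq_to_K] at h
    exact_mod_cast h
  have hle : ∀ φ : FormSpace D, ‖FormSpace.incl D φ‖ ≤ ‖φ‖ := fun φ => by
    refine (pow_le_pow_iff_left₀ (norm_nonneg _) (norm_nonneg _) two_ne_zero).1 ?_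
    rw [hnorm]
    exact le_add_of_nonneg_right (hp φ).1
  have hqle : ∀ φ : FormSpace D, ‖q φ φ‖ ≤ ‖φ‖ ^ 2 := fun φ => by
    rw [hq φ, Complex.norm_real, Real.norm_of_nonneg (hp φ).1, hnorm]
    exact le_add_of_nonneg_left (sq_nonneg _)
  let j : FormSpace D →L[ℂ] H :=
    (FormSpace.incl D).mkContinuous 1 fun φ => by rw [one_mul]; exact hle φ
  -- A Cauchy sequence for the form norm is Cauchy both in H and for q, so closedness of q supplies
  -- its limit in D.
  have hcomplete : CompleteSpace (FormSpace D) := by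
    refine Metric.complete_of_cauchySeq_tendsto fun u hu => ?_
    obtain ⟨φ, hφ⟩ := cauchySeq_tendsto_of_complete (j.uniformContinuous.comp_cauchySeq hu)
    have h0 : Tendsto (fun p : ℕ × ℕ => ‖u p.1 - u p.2‖ ^ 2) (atTop ×ˢ atTop) (𝓝 0) := by
      have h := (cauchySeq_iff_tendsto_dist_atTop_0.1 hu).pow 2
      rw [zero_pow two_ne_zero, ← prod_atTop_atTop_eq] at h
      exact h.congr fun p => by rw [dist_eq_norm]
    obtain ⟨hm, hlim⟩ := hc u φ hφ (squeeze_zero_norm (fun p => hqle (u p.1 - u p.2)) h0)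
    let g : FormSpace D := (⟨φ, hm⟩ : D)
    refine ⟨g, ?_⟩
    have h1 : Tendsto (fun n => ‖u n - g‖ ^ 2) atTop (𝓝 0) := by
      have ha := (tendsto_iff_norm_sub_tendsto_zero.1 hφ).pow 2
      have hb := (Complex.continuous_re.tendsto _).comp hlim
      have hab := ha.add hb
      rw [zero_pow two_ne_zero, Complex.zero_re, add_zero] at hab
      exact hab.congr fun n => (hnorm (u n - g)).symm
    have h2 := (Real.continuous_sqrt.tendsto _).comp h1
    rw [Real.sqrt_zero] at h2
    exact tendsto_iff_norm_sub_tendsto_zero.2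
      (h2.congr fun n => Real.sqrt_sq (norm_nonneg _))
  have hj : Function.Injective j := fun a b h => Subtype.ext h
  have hd : DenseRange j := by
    refine hD.mono fun x hx => ?_
    exact ⟨(⟨x, hx⟩ : D), rfl⟩
  obtain ⟨S, hS, hSS, hdom, hform⟩ := exists_sqrt_of_embedding j hj hd hle
  have hdomD : S.domain = D := by
    ext x
    rw [hdom]
    exact ⟨fun ⟨g, hg⟩ => hg ▸ Subtype.property (p := (· ∈ D)) g, fun hx => ⟨(⟨x, hx⟩ : D), rfl⟩⟩
  refine ⟨S, hS, hSS, hdomD, fun ψ φ => ?_⟩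
  -- The form inner product minus the inner product of H is q.
  refine Eq.trans ?_ (hform ψ φ (hdomD.symm ▸ ψ.2) (hdomD.symm ▸ φ.2)).symm
  exact (add_sub_cancel_left _ _).symm

theorem isAssociated_toOperator [CompleteSpace H] (q : FormOn D) (hD : Dense (D : Set H))
    (hs : q.IsSymm) (hp : q.IsPos) (hc : q.IsClosed) : q.IsAssociated (q.toOperator hD) := by
  obtain ⟨S, hS, hSS, hdom, hq⟩ := q.exists_sqrt hD hs hp hc
  have h : q.IsAssociated (S.natComp S) := ⟨hSS, S, hS, rfl, hdom, hq⟩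
  rwa [← q.eq_toOperator_of_isAssociated hD h]

end FormOn

end

/-! ### The form integral: diagonal values, symmetry, positivity, closedness. -/

noncomputable section

namespace POVM

variable {Ω : Type*} [MeasurableSpace Ω] {H : Type*} [NormedAddCommGroup H]
  [InnerProductSpace ℂ H] [CompleteSpace H]

theorem scal_self_apply (E : POVM Ω H) (φ : H) {X : Set Ω} (hX : MeasurableSet X) :
    E.scal φ φ X = ((E.diag φ).real X : ℂ) := by
  rw [scal_apply, Measure.real, E.diag_apply φ hX, ENNReal.toReal_ofReal (E.re_nonneg X φ)]
  refine Complex.ext rfl ?_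
  rw [Complex.ofReal_im]
  exact Complex.conj_eq_iff_im.1 (E.isSymm_apply X φ φ).symm

theorem variation_scal_self_le (E : POVM Ω H) (φ : H) :
    (E.scal φ φ).variation ≤ E.diag φ := by
  refine VectorMeasure.variation_le_of_forall_enorm_le fun X hX => ?_
  rw [E.scal_self_apply φ hX, ← ofReal_norm, Complex.norm_real, Real.norm_of_nonneg
    measureReal_nonneg, ofReal_measureReal]

/-- The integral with respect to `E_{φ,φ}` as a complex and as a positive measure agree. -/
theorem cintegral_scal_self (E : POVM Ω H) (φ : H) {f : Ω → ℂ} (hf : Integrable f (E.diag φ)) :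
    VectorMeasure.cintegral (E.scal φ φ) f = ∫ ω, f ω ∂(E.diag φ) := by
  have hv := E.variation_scal_self_le φ
  have hT := dominatedFinMeasAdditive_cbmApplyMeasure (E.scal φ φ) (ContinuousLinearMap.mul ℝ ℂ)
  have hT' := hT.of_measure_le hv (ContinuousLinearMap.opNorm_nonneg _)
  rw [integral_eq_setToFun]
  -- Domination passes from the variation to the larger measure E_{φ,φ}. Over that measure both
  -- integrals extend the same set function.
  refine (setToFun_congr_measure_of_integrable 1 ENNReal.one_ne_top
    (by rwa [one_smul]) hT' hT f hf).symm.trans ?_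
  refine setToFun_congr_left' _ _ (fun s hs _ => ?_) f
  refine ContinuousLinearMap.ext fun z => ?_
  change z * E.scal φ φ s = (E.diag φ).real s • z
  rw [E.scal_self_apply φ hs, Complex.real_smul, mul_comm]

section Form

variable (E : POVM Ω H) {f : Ω → ℝ} (hf : Measurable f) (hpos : ∀ ω, 0 ≤ f ω)

include hpos in
-- The properties of q are read off from these values. Nothing is lost in `toReal`, since membership
-- in the form domain is finiteness of the integral.
theorem formIntegral_self (φ : E.formDomain fun ω => (f ω : ℂ)) :
    E.formIntegral (fun ω => (f ω : ℂ)) hf.complex_ofReal φ φ =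
      ((∫⁻ ω, ‖(f ω : ℂ)‖ₑ ∂(E.diag φ)).toReal : ℂ) := by
  have hint : Integrable (fun ω => (f ω : ℂ)) (E.diag φ) :=
    ⟨hf.complex_ofReal.aestronglyMeasurable, φ.2⟩
  refine (E.cintegral_scal_self φ hint).trans ?_
  rw [integral_complex_ofReal, integral_eq_lintegral_of_nonneg_ae
    (Eventually.of_forall hpos) hf.aestronglyMeasurable]
  congr 3
  funext ω
  rw [← ofReal_norm, Complex.norm_real, Real.norm_of_nonneg (hpos ω)]

include hpos in
theorem formIntegral_isPos :
    (E.formIntegral (fun ω => (f ω : ℂ)) hf.complex_ofReal).IsPos := fun φ => by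
  rw [E.formIntegral_self hf hpos, Complex.ofReal_re, Complex.ofReal_im]
  exact ⟨ENNReal.toReal_nonneg, rfl⟩

include hpos in
theorem formIntegral_isSymm :
    (E.formIntegral (fun ω => (f ω : ℂ)) hf.complex_ofReal).IsSymm :=
  sesquilinear_symm_of_diag_im _ fun φ => (E.formIntegral_isPos hf hpos φ).2

/-- The map `φ ↦ ∫ g dE_{φ,φ}` is lower semicontinuous. -/
theorem lowerSemicontinuous_lintegral_diag {g : Ω → ℝ≥0∞} (hg : Measurable g) :
    LowerSemicontinuous fun φ : H => ∫⁻ ω, g ω ∂(E.diag φ) := by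
  -- For a simple function the integral is a finite sum of terms c · E_{φ,φ}(X), each continuous in
  -- φ. The values c of `eapprox` are finite, which continuity of multiplication by c requires.
  simp_rw [lintegral_eq_iSup_eapprox_lintegral hg]
  refine lowerSemicontinuous_iSup fun n => Continuous.lowerSemicontinuous ?_
  unfold SimpleFunc.lintegral
  refine continuous_finsetSum _ fun c hc => ENNReal.continuous_const_mul ?_ |>.comp ?_
  · obtain ⟨ω, rfl⟩ := SimpleFunc.mem_range.1 hc
    exact (SimpleFunc.eapprox_lt_top g n ω).ne
  · simp_rw [E.diag_apply _ ((SimpleFunc.eapprox g n).measurableSet_fiber c)]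
    exact ENNReal.continuous_ofReal.comp (by fun_prop)

include hpos in
-- For fixed large n, lower semicontinuity carries the bound on q(φₙ - φₘ, φₙ - φₘ) to the limit m →
-- ∞. The integral over E for φₙ - φ is then at most ε, which yields both φ ∈ D and the convergence.
theorem formIntegral_isClosed :
    (E.formIntegral (fun ω => (f ω : ℂ)) hf.complex_ofReal).IsClosed := by
  intro u φ hu hq
  have hlsc := E.lowerSemicontinuous_lintegral_diag (g := fun ω => ‖(f ω : ℂ)‖ₑ)
    hf.complex_ofReal.enorm
  have hbound : ∀ ε : ℝ, 0 < ε → ∀ᶠ n in atTop,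
      ∫⁻ ω, ‖(f ω : ℂ)‖ₑ ∂(E.diag ((u n : H) - φ)) ≤ ENNReal.ofReal ε := by
    intro ε hε
    have hev := hq.eventually (Metric.ball_mem_nhds 0 hε)
    rw [prod_atTop_atTop_eq] at hev
    obtain ⟨N, hN⟩ := eventually_atTop_prod_self.1 hev
    filter_upwards [eventually_ge_atTop N] with n hn
    have ht : Tendsto (fun m => (u n : H) - u m) atTop (𝓝 (u n - φ)) := hu.const_sub _
    refine (hlsc.isClosed_preimage (ENNReal.ofReal ε)).mem_of_tendsto ht ?_
    filter_upwards [eventually_ge_atTop N] with m hm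
    have h := hN n m hn hm
    simp only [E.formIntegral_self hf hpos, dist_zero_right, Complex.norm_real,
      Real.norm_of_nonneg ENNReal.toReal_nonneg] at h
    exact (ENNReal.le_ofReal_iff_toReal_le (u n - u m).2.ne hε.le).2 h.le
  -- Any finite bound would do here: φ = φₙ - (φₙ - φ) is a difference of elements of the form
  -- domain.
  obtain ⟨n, hn⟩ := (hbound 1 one_pos).exists
  have hm : (u n : H) - φ ∈ E.formDomain fun ω => (f ω : ℂ) := hn.trans_lt ENNReal.ofReal_lt_top
  have hφ : φ ∈ E.formDomain fun ω => (f ω : ℂ) := by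
    simpa using Submodule.sub_mem _ (u n).2 hm
  refine ⟨hφ, Metric.tendsto_nhds.2 fun ε hε => ?_⟩
  filter_upwards [hbound (ε / 2) (half_pos hε)] with n hn
  rw [E.formIntegral_self hf hpos, dist_zero_right, Complex.norm_real,
    Real.norm_of_nonneg ENNReal.toReal_nonneg]
  exact (ENNReal.toReal_le_of_le_ofReal (half_pos hε).le hn).trans_lt (half_lt_self hε)

end Form

/-! ### The strong operator integral of a spectral measure as an L² isometry. -/

section Spectral

variable {F : POVM Ω H}

theorem IsSpectral.exists_hasVectorIntegral (hF : F.IsSpectral) {x : H} {f : Ω → ℂ}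
    (hf : Measurable f) (hmem : MemLp f 2 (F.diag x)) :
    ∃ ν, (F.vec x).HasVectorIntegral f ν := by
  obtain ⟨ν, hν⟩ := cauchySeq_tendsto_of_complete
    (u := fun n => (F.vec x).simpleIntegral (approx f hf n) Set.univ)
    (EMetric.cauchySeq_iff.2 fun ε hε => by
      have ht := tendsto_eLpNorm_approx f hf (F.diag x) hmem
      obtain ⟨N, hN⟩ := eventually_atTop.1 (ht.eventually_lt_const (ENNReal.half_pos hε.ne'))
      refine ⟨N, fun m hm n hn => ?_⟩
      rw [edist_eq_enorm_sub, ← simpleIntegral_sub _ _ _ MeasurableSet.univ,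
        hF.enorm_simpleIntegral x _ MeasurableSet.univ, Measure.restrict_univ,
        SimpleFunc.coe_sub, ← sub_sub_sub_cancel_right _ _ f]
      refine (eLpNorm_sub_le
        ((approx f hf m).aestronglyMeasurable.sub hf.aestronglyMeasurable)
        ((approx f hf n).aestronglyMeasurable.sub hf.aestronglyMeasurable)
        (by norm_num)).trans_lt ?_
      rw [← ENNReal.add_halves ε]
      exact ENNReal.add_lt_add (hN m hm) (hN n hn))
  exact ⟨ν, hF.hasVectorIntegral_of_tendsto hf hmem hν⟩

/-- Simple functions are integrated isometrically from L²(F_{x,x}), so convergence of their vector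
integrals is convergence in L². -/
theorem IsSpectral.mem_strongIntegral_domain (hF : F.IsSpectral) {x : H} {f : Ω → ℂ}
    (hf : Measurable f) :
    x ∈ (F.strongIntegral hF f hf).domain ↔ MemLp f 2 (F.diag x) :=
  ⟨fun ⟨_, h⟩ => (hF.tendsto_of_hasVectorIntegral hf h).1, hF.exists_hasVectorIntegral hf⟩

/-- The isometry property of the strong operator integral. -/
theorem IsSpectral.enorm_strongIntegral (hF : F.IsSpectral) {f : Ω → ℂ} (hf : Measurable f)
    (x : (F.strongIntegral hF f hf).domain) :
    ‖F.strongIntegral hF f hf x‖ₑ = eLpNorm f 2 (F.diag x) := by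
  obtain ⟨hmem, ht⟩ := hF.tendsto_of_hasVectorIntegral hf x.2.choose_spec
  have hn := ht.enorm
  simp_rw [hF.enorm_simpleIntegral _ _ MeasurableSet.univ, Measure.restrict_univ] at hn
  have h0 := tendsto_eLpNorm_approx f hf (F.diag x) hmem
  have hfm := hf.aestronglyMeasurable (μ := F.diag (x : H))
  have ham := fun n => (approx f hf n).aestronglyMeasurable (μ := F.diag (x : H))
  -- The L² norms of the approximants tend to the norm of the vector integral; the triangle
  -- inequality, used in both directions, compares them with the norm of f.
  refine le_antisymm ?_ ?_
  · refine le_of_tendsto_of_tendsto' hn (by simpa using h0.add_const (eLpNorm f 2 (F.diag x)))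
      fun n => ?_
    simpa using eLpNorm_add_le ((ham n).sub hfm) hfm (p := 2) (by norm_num)
  · have hlim := h0.add hn
    rw [zero_add] at hlim
    refine le_of_tendsto_of_tendsto' tendsto_const_nhds hlim fun n => ?_
    rw [eLpNorm_sub_comm]
    simpa using eLpNorm_add_le (hfm.sub (ham n)) (ham n) (p := 2) (by norm_num)

end Spectral

/-! ### Naimark dilations and the factorization of the form. -/

section Dilation

variable {K : Type*} [NormedAddCommGroup K] [InnerProductSpace ℂ K] [CompleteSpace K]
  {E : POVM Ω H} {F : POVM Ω K} {V : H →L[ℂ] K}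

theorem IsNaimarkDilation.diag_eq (h : E.IsNaimarkDilation F V) (φ : H) :
    F.diag (V φ) = E.diag φ := by
  refine Measure.ext fun X hX => ?_
  rw [F.diag_apply _ hX, E.diag_apply _ hX, h.eq_comp X hX]
  simp [ContinuousLinearMap.adjoint_inner_right]

theorem enorm_ofReal_sqrt_sq {r : ℝ} (hr : 0 ≤ r) : ‖((√r : ℝ) : ℂ)‖ₑ ^ 2 = ‖(r : ℂ)‖ₑ := by
  rw [← enorm_pow, ← Complex.ofReal_pow, Real.sq_sqrt hr]

theorem eLpNorm_sqrt_sq {f : Ω → ℝ} (hpos : ∀ ω, 0 ≤ f ω) (μ : Measure Ω) :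
    eLpNorm (fun ω => ((√(f ω) : ℝ) : ℂ)) 2 μ ^ 2 = ∫⁻ ω, ‖(f ω : ℂ)‖ₑ ∂μ := by
  have h := eLpNorm_nnreal_pow_eq_lintegral (p := 2) (f := fun ω => ((√(f ω) : ℝ) : ℂ)) (μ := μ)
    (by norm_num)
  simp only [NNReal.coe_ofNat, ENNReal.coe_ofNat, ENNReal.rpow_ofNat] at h
  rw [h]
  exact lintegral_congr fun ω => enorm_ofReal_sqrt_sq (hpos ω)

variable {f : Ω → ℝ} (hf : Measurable f) (hpos : ∀ ω, 0 ≤ f ω)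

include hpos in
-- √f is square integrable for F_{Vφ,Vφ} = E_{φ,φ} exactly when f is integrable for it.
theorem IsNaimarkDilation.compBounded_domain (h : E.IsNaimarkDilation F V) :
    ((F.strongIntegral h.isSpectral (fun ω => (√(f ω) : ℂ))
      hf.sqrt.complex_ofReal).compBounded V).domain = E.formDomain fun ω => (f ω : ℂ) := by
  ext φ
  have hiff : φ ∈ ((F.strongIntegral h.isSpectral (fun ω => (√(f ω) : ℂ))
      hf.sqrt.complex_ofReal).compBounded V).domain ↔
      MemLp (fun ω => ((√(f ω) : ℝ) : ℂ)) 2 (F.diag (V φ)) :=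
    LinearPMap.mem_natComp_domain.trans
      ⟨fun ⟨_, hx⟩ => (h.isSpectral.mem_strongIntegral_domain hf.sqrt.complex_ofReal).1 hx,
        fun hx => ⟨trivial,
          (h.isSpectral.mem_strongIntegral_domain hf.sqrt.complex_ofReal).2 hx⟩⟩
  rw [hiff, h.diag_eq]
  change _ ↔ ∫⁻ ω, ‖(f ω : ℂ)‖ₑ ∂(E.diag φ) < ∞
  rw [← eLpNorm_sqrt_sq hpos, ENNReal.pow_lt_top_iff]
  simp [MemLp, hf.sqrt.complex_ofReal.aestronglyMeasurable]

include hpos in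
-- By polarization only the diagonal matters, and there the isometry property gives ‖L(√f, F)Vφ‖² =
-- ∫ f dE_{φ,φ}.
theorem IsNaimarkDilation.formIntegral_eq (h : E.IsNaimarkDilation F V)
    (ψ φ : E.formDomain fun ω => (f ω : ℂ)) :
    E.formIntegral (fun ω => (f ω : ℂ)) hf.complex_ofReal ψ φ =
      ⟪(F.strongIntegral h.isSpectral (fun ω => (√(f ω) : ℂ))
        hf.sqrt.complex_ofReal).compBounded V ⟨ψ, (h.compBounded_domain hf hpos).symm ▸ ψ.2⟩,
      (F.strongIntegral h.isSpectral (fun ω => (√(f ω) : ℂ))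
        hf.sqrt.complex_ofReal).compBounded V
          ⟨φ, (h.compBounded_domain hf hpos).symm ▸ φ.2⟩⟫_ℂ := by
  set A := (F.strongIntegral h.isSpectral (fun ω => (√(f ω) : ℂ))
    hf.sqrt.complex_ofReal).compBounded V with hA
  have hle := (h.compBounded_domain hf hpos).ge
  refine sesquilinear_eq_inner_of_diag (E.formIntegral (fun ω => (f ω : ℂ)) hf.complex_ofReal)
    (A.toFun ∘ₗ Submodule.inclusion hle) (fun φ => ?_) ψ φ
  rw [E.formIntegral_self hf hpos]
  have hm := (LinearPMap.mem_natComp_domain.1 (hle φ.2)).choose_spec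
  have e : ‖(A.toFun ∘ₗ Submodule.inclusion hle) φ‖ₑ =
      eLpNorm (fun ω => ((√(f ω) : ℝ) : ℂ)) 2 (F.diag (V φ)) :=
    h.isSpectral.enorm_strongIntegral hf.sqrt.complex_ofReal ⟨V φ, hm⟩
  rw [inner_self_eq_norm_sq_to_K, ← eLpNorm_sqrt_sq hpos, ← h.diag_eq, ← e,
    ENNReal.toReal_pow, toReal_enorm]
  push_cast
  rfl

end Dilation

end POVM

end

theorem proposition10 {Ω : Type u} [MeasurableSpace Ω] {H : Type v} [NormedAddCommGroup H]
    [InnerProductSpace ℂ H] [CompleteSpace H] (E : POVM Ω H) (f : Ω → ℝ) (hf : Measurable f)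
    (hpos : ∀ ω, 0 ≤ f ω)
    (hdense : Dense (E.formDomain (fun ω => (f ω : ℂ)) : Set H)) :
    (E.formIntegral (fun ω => (f ω : ℂ)) hf.complex_ofReal).IsSymm ∧
    (E.formIntegral (fun ω => (f ω : ℂ)) hf.complex_ofReal).IsPos ∧
    (E.formIntegral (fun ω => (f ω : ℂ)) hf.complex_ofReal).IsClosed ∧
    ∃ T : H →ₗ.[ℂ] H,
      (E.formIntegral (fun ω => (f ω : ℂ)) hf.complex_ofReal).IsAssociated T ∧
      (∀ T' : H →ₗ.[ℂ] H,
        (E.formIntegral (fun ω => (f ω : ℂ)) hf.complex_ofReal).IsAssociated T' → T' = T) ∧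
      (∀ (K : Type w) [NormedAddCommGroup K] [InnerProductSpace ℂ K] [CompleteSpace K]
        (F : POVM Ω K) (V : H →L[ℂ] K) (h : E.IsNaimarkDilation F V),
        T = LinearPMap.natComp
          ((F.strongIntegral h.isSpectral (fun ω => (√(f ω) : ℂ))
            hf.sqrt.complex_ofReal).compBounded V).adjoint
          ((F.strongIntegral h.isSpectral (fun ω => (√(f ω) : ℂ))
            hf.sqrt.complex_ofReal).compBounded V)) ∧
      T = E.largestSymmWeakIntegral (fun ω => (f ω : ℂ)) hf.complex_ofReal hdense ∧
      IsSelfAdjoint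
        (E.largestSymmWeakIntegral (fun ω => (f ω : ℂ)) hf.complex_ofReal hdense) := by
  have hsymm := E.formIntegral_isSymm hf hpos
  have hp := E.formIntegral_isPos hf hpos
  have hc := E.formIntegral_isClosed hf hpos
  have hass := FormOn.isAssociated_toOperator _ hdense hsymm hp hc
  -- The witness T is the operator determined by q, which is the largest symmetric weak integral by
  -- definition; hence `rfl`.
  refine ⟨hsymm, hp, hc, _, hass,
    fun T' hT' => FormOn.eq_toOperator_of_isAssociated _ hdense hT', ?_, rfl, hass.1.1⟩
  intro K _ _ _ F V h
  exact FormOn.toOperator_eq_adjoint_natComp _ hdense _ (h.compBounded_domain hf hpos)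
    (h.formIntegral_eq hf hpos)
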